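/- For a real number $c\neq 0$ and $r\ge 1$ let $$\tilde{\mathfrak H}_r(t_1,\dots,t_r;c)=\prod_{j=1}^{r}\left(\frac{1}{e^{t_j+\cdots+t_r}-1}-\frac{c}{e^{c(t_j+\cdots+t_r)}-1}\right),$$ where the removable singularities of the factors at $t_j+\cdots+t_r=0$ are filled in. Let $\mathcal C$ be the Hankel contour of sufficiently small radius $\varepsilon>0$: it comes from $+\infty$ to $\varepsilon$ along the top side of the positive real axis, runs once counterclockwise around the circle $|t|=\varepsilon$, and returns to $+\infty$ along the bottom side of the positive real axis; along $\mathcal C$ the argument of $t$ in $t^{s-1}$ increases from $0$ to $2\pi$. The desingularized multiple zeta function is defined for $s_1,\dots,s_r\in\mathbb C\setminus\mathbb Z$ by $$\zeta^{\rm des}_r(s_1,\dots,s_r)=\lim_{c\to1,\,c\ne1}\frac{1}{(1-c)^r}\prod_{k=1}^{r}\frac{1}{(e^{2\pi i s_k}-1)\Gamma(s_k)}\int_{\mathcal C^r}\tilde{\mathfrak H}_r(t_1,\dots,t_r;c)\prod_{k=1}^{r}t_k^{s_k-1}\,dt_k,$$ and at the other points of $\mathbb C^r$ by analytic continuation. Proposition.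 Let $n,m$ be positive integers. Then $\zeta^{\rm des}_1$ continues holomorphically to neighbourhoods of $n$ and of $m$, $\zeta^{\rm des}_2$ continues holomorphically to a neighbourhood of $(n+m-j,j)$ for every $1\le j\le n+m-1$, and the values of the continuations satisfy $$\zeta^{\rm des}_1(n)\,\zeta^{\rm des}_1(m)=\sum_{j=1}^{n+m-1}\left\{\binom{j-1}{n-1}+\binom{j-1}{m-1}\right\}\zeta^{\rm des}_2(n+m-j,j),$$ where $\binom{k}{i}=0$ for $k<i$. -/

import Mathlib

open Filter Topology

noncomputable section

namespace DesMZF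

/-- The one-variable factor `1/(e^x - 1) - c/(e^{cx} - 1) = ∑_{m ≥ 1} (1 - c^m) B_m x^{m-1}/m!`.
At `x = 0`, a removable singularity, it has the value `(1 - c) B_1 = (c - 1)/2` of the series. -/
def kernelFactor (c : ℝ) (x : ℂ) : ℂ :=
  if x = 0 then ((c : ℂ) - 1) / 2
  else 1 / (Complex.exp x - 1) - (c : ℂ) / (Complex.exp ((c : ℂ) * x) - 1)

/-- The generating function `∏_j (1/(e^{t_j+⋯+t_r} - 1) - c/(e^{c(t_j+⋯+t_r)} - 1))`. -/
def kernel (r : ℕ) (c : ℝ) (t : Fin r → ℂ) : ℂ :=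
  ∏ j : Fin r, kernelFactor c (∑ k ∈ Finset.Ici j, t k)

/-! The Hankel contour of radius `ε`, parametrized by `u ∈ ℝ`: for `u ≤ 0` it comes in from `+∞`
to `ε` along the top side of the positive real axis (argument `0`), for `0 ≤ u ≤ 2π` it runs once
counterclockwise around the circle of radius `ε`, and for `u ≥ 2π` it goes back from `ε` to `+∞`
along the bottom side of the axis (argument `2π`). -/

/-- The modulus of the point of the Hankel contour with parameter `u`. -/
def hankelRadius (ε u : ℝ) : ℝ :=
  if u < 0 then ε - u else if u ≤ 2 * Real.pi then ε else ε + (u - 2 * Real.pi)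

/-- The continuously chosen argument, from `0` to `2π`, along the Hankel contour. -/
def hankelArg (u : ℝ) : ℝ :=
  if u < 0 then 0 else if u ≤ 2 * Real.pi then u else 2 * Real.pi

/-- The continuous branch of `log t` along the Hankel contour. -/
def hankelLog (ε u : ℝ) : ℂ :=
  (Real.log (hankelRadius ε u) : ℂ) + (hankelArg u : ℂ) * Complex.I

/-- The point `t` of the Hankel contour with parameter `u`. -/
def hankelPoint (ε u : ℝ) : ℂ :=
  (hankelRadius ε u : ℂ) * Complex.exp ((hankelArg u : ℂ) * Complex.I)

/-- The velocity `dt/du` along the Hankel contour. -/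
def hankelVelocity (ε u : ℝ) : ℂ :=
  if u < 0 then -1
  else if u ≤ 2 * Real.pi then Complex.I * (ε : ℂ) * Complex.exp ((u : ℂ) * Complex.I)
  else 1

/-- The `r`-fold contour integral `∫_{C^r} f(t_1,…,t_r) ∏_k t_k^{s_k - 1} dt_k` over the `r`-th
power of the Hankel contour `C` of radius `ε`. -/
def hankelIntegral (r : ℕ) (ε : ℝ) (f : (Fin r → ℂ) → ℂ) (s : Fin r → ℂ) : ℂ :=
  ∫ u : Fin r → ℝ, f (fun k => hankelPoint ε (u k)) *
    ∏ k, (Complex.exp ((s k - 1) * hankelLog ε (u k)) * hankelVelocity ε (u k))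

/-- `C(s) = ∏_k 1/((e^{2πi s_k} - 1) Γ(s_k))`. -/
def hankelCoeff (r : ℕ) (s : Fin r → ℂ) : ℂ :=
  ∏ k, 1 / ((Complex.exp (2 * Real.pi * Complex.I * s k) - 1) * Complex.Gamma (s k))

/-- The set `(ℂ ∖ ℤ)^r`. -/
def nonint (r : ℕ) : Set (Fin r → ℂ) :=
  {s | ∀ k, s k ∉ Set.range ((↑) : ℤ → ℂ)}

/-- For `s ∈ (ℂ ∖ ℤ)^r`: the defining formula
`v = lim_{c → 1, c ≠ 1} (1 - c)^{-r} C(s) ∫_{C^r} kernel(t; c) ∏ t_k^{s_k - 1} dt_k`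
holds, for every Hankel contour `C` of sufficiently small radius. -/
def IsDesZetaLimit (r : ℕ) (s : Fin r → ℂ) (v : ℂ) : Prop :=
  ∀ᶠ ε : ℝ in 𝓝[>] 0,
    Tendsto
      (fun c : ℝ => 1 / (1 - (c : ℂ)) ^ r * hankelCoeff r s * hankelIntegral r ε (kernel r c) s)
      (𝓝[≠] 1) (𝓝 v)

/-- `v` is the value at `s ∈ ℂ^r` of the analytic continuation of the function defined on
`(ℂ ∖ ℤ)^r` by `IsDesZetaLimit`: a holomorphic function `F` on an open neighbourhood `U` of `s`
coincides with that function on `U ∩ (ℂ ∖ ℤ)^r`, and `F s = v`. -/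
def IsDesZetaValue (r : ℕ) (s : Fin r → ℂ) (v : ℂ) : Prop :=
  ∃ (U : Set (Fin r → ℂ)) (F : (Fin r → ℂ) → ℂ), IsOpen U ∧ s ∈ U ∧ DifferentiableOn ℂ F U ∧
    (∀ z ∈ U ∩ nonint r, IsDesZetaLimit r z (F z)) ∧ F s = v

theorem dense_nonint (r : ℕ) : Dense (nonint r) := by
  have h1 : Dense ((Set.range ((↑) : ℤ → ℂ))ᶜ) :=
    (Set.countable_range ((↑) : ℤ → ℂ)).dense_compl ℝ
  have h2 := dense_pi (Set.univ : Set (Fin r)) (fun _ _ => h1)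
  convert h2 using 1
  ext s
  simp [nonint]

theorem IsDesZetaLimit.unique {r : ℕ} {s : Fin r → ℂ} {v w : ℂ}
    (hv : IsDesZetaLimit r s v) (hw : IsDesZetaLimit r s w) : v = w := by
  obtain ⟨ε, h1, h2⟩ := (hv.and hw).exists
  exact tendsto_nhds_unique h1 h2

/-- The value of the analytic continuation at a point is unique. -/
theorem IsDesZetaValue.unique {r : ℕ} {s : Fin r → ℂ} {v w : ℂ}
    (hv : IsDesZetaValue r s v) (hw : IsDesZetaValue r s w) : v = w := by
  obtain ⟨U, F, hU, hsU, hF, hFl, rfl⟩ := hv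
  obtain ⟨V, G, hV, hsV, hG, hGl, rfl⟩ := hw
  have hne : (𝓝[nonint r] s).NeBot := mem_closure_iff_nhdsWithin_neBot.1 (dense_nonint r s)
  have hFc : Tendsto F (𝓝[nonint r] s) (𝓝 (F s)) :=
    ((hF.differentiableAt (hU.mem_nhds hsU)).continuousAt).tendsto.mono_left nhdsWithin_le_nhds
  have hGc : Tendsto G (𝓝[nonint r] s) (𝓝 (G s)) :=
    ((hG.differentiableAt (hV.mem_nhds hsV)).continuousAt).tendsto.mono_left nhdsWithin_le_nhds
  refine tendsto_nhds_unique hFc (hGc.congr' ?_)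
  filter_upwards [self_mem_nhdsWithin, nhdsWithin_le_nhds (hU.mem_nhds hsU),
    nhdsWithin_le_nhds (hV.mem_nhds hsV)] with z hz hzU hzV
  exact (hGl z ⟨hzV, hz⟩).unique (hFl z ⟨hzU, hz⟩)

open Classical in
/-- The desingularized multiple zeta function `ζ_r^des(s_1,…,s_r)`: the value at `s` of the
analytic continuation (and `0` where there is no continuation). -/
def desZeta (r : ℕ) (s : Fin r → ℂ) : ℂ :=
  if h : ∃ v, IsDesZetaValue r s v then h.choose else 0

end DesMZF

end

/-!
If all `s_k` have positive real part, the Hankel contours can be collapsed onto the positive real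
axis, each variable contributing a factor `e^(2πi s_k) - 1`, and the limit `c → 1` can be taken
under the integral sign, because `kernelFactor c x / (1 - c)` converges to
`limitFactor x = d/dx (x / (e^x - 1))` with an exponentially decaying majorant. So `desZeta r` is
there the Mellin transform of `∏_j φ(x_j + ⋯ + x_r)` with `φ = limitFactor`, which is holomorphic.
In particular
`desZeta 1 (n) = ∫ φ(x) x^(n-1)/(n-1)! dx` and
`desZeta 2 (i, j) = ∫∫ φ(x+y) φ(y) x^(i-1)/(i-1)! y^(j-1)/(j-1)! dx dy`.
Cutting the integral for `desZeta 1 (n) * desZeta 1 (m)` along the diagonal of the quadrant and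
shearing the two halves back onto the quadrant turns the integrand into
`φ(x+y) φ(y) (x+y)^(n-1)/(n-1)! y^(m-1)/(m-1)!` plus the same with `n` and `m` exchanged, and the
binomial theorem finishes the proof.
-/

noncomputable section

namespace DesMZF

open MeasureTheory Complex
open Finset.HasAntidiagonal (antidiagonal)

/-! ### The Bernoulli generating function and the kernel factor -/

/-- The generating function `z / (e^z - 1)` of the Bernoulli numbers, encoded as the inverse of
`(e^z - 1) / z` with its removable singularity filled in, so that its value at `0` is `1`. -/
def bernoulliGen (z : ℂ) : ℂ := (dslope exp 0 z)⁻¹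

/-- The derivative of `z / (e^z - 1)`: the limit of `kernelFactor c / (1 - c)` as `c → 1`. -/
def limitFactor (z : ℂ) : ℂ := deriv bernoulliGen z

/-- The half-strip `Re z > -δ`, `|Im z| < δ`: a neighbourhood of the positive real axis that
contains the Hankel contours of small radius. -/
def halfStrip (δ : ℝ) : Set ℂ := {z | -δ < z.re ∧ |z.im| < δ}

/-- The decay rate `e^(-Re z / 4)` of the kernel factors along `halfStrip 1`, uniformly in
`1 / 2 ≤ c ≤ 2`. -/
def decay (z : ℂ) : ℝ := Real.exp (-z.re / 4)

theorem isOpen_halfStrip (δ : ℝ) : IsOpen (halfStrip δ) :=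
  (isOpen_lt continuous_const continuous_re).inter (isOpen_lt continuous_im.abs continuous_const)

theorem halfStrip_mono {δ δ' : ℝ} (h : δ ≤ δ') : halfStrip δ ⊆ halfStrip δ' :=
  fun _ hz => ⟨by linarith [hz.1], hz.2.trans_le h⟩

theorem ofReal_mem_halfStrip {δ x : ℝ} (hδ : 0 < δ) (hx : 0 < x) : (x : ℂ) ∈ halfStrip δ :=
  ⟨by rw [ofReal_re]; linarith, by rwa [ofReal_im, abs_zero]⟩

theorem add_mem_halfStrip {δ δ' : ℝ} {z w : ℂ} (hz : z ∈ halfStrip δ) (hw : w ∈ halfStrip δ') :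
    z + w ∈ halfStrip (δ + δ') := by
  refine ⟨?_, ?_⟩
  · rw [add_re]; linarith [hz.1, hw.1]
  · rw [add_im]; exact (abs_add_le _ _).trans_lt (add_lt_add hz.2 hw.2)

theorem ofReal_mul_mem_halfStrip {a δ : ℝ} {z : ℂ} (ha : 0 < a) (hz : z ∈ halfStrip δ) :
    (a : ℂ) * z ∈ halfStrip (a * δ) := by
  refine ⟨?_, ?_⟩
  · rw [re_ofReal_mul]; nlinarith [hz.1]
  · rw [im_ofReal_mul, abs_mul, abs_of_pos ha]; exact mul_lt_mul_of_pos_left hz.2 ha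

theorem abs_im_lt_two_pi {z : ℂ} (hz : z ∈ halfStrip 3) : |z.im| < 2 * Real.pi :=
  hz.2.trans (by linarith [Real.pi_gt_three])

theorem bernoulliGen_of_ne {z : ℂ} (hz : z ≠ 0) : bernoulliGen z = z / (exp z - 1) := by
  rw [bernoulliGen, dslope_of_ne _ hz, slope_def_field, inv_div, exp_zero, sub_zero]

theorem differentiable_dslope_exp : Differentiable ℂ (dslope exp 0) := by
  rw [← differentiableOn_univ, differentiableOn_dslope univ_mem]
  exact differentiable_exp.differentiableOn

theorem exp_ne_one_of_abs_im_lt {z : ℂ} (h0 : z ≠ 0) (hz : |z.im| < 2 * Real.pi) :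
    exp z ≠ 1 := by
  intro h
  obtain ⟨n, rfl⟩ := exp_eq_one_iff.1 h
  have hn : n ≠ 0 := by rintro rfl; simp at h0
  have one_le : (1 : ℝ) ≤ |(n : ℝ)| := by exact_mod_cast Int.one_le_abs hn
  have him : ((n : ℂ) * (2 * Real.pi * I)).im = n * (2 * Real.pi) := by simp
  rw [him, abs_mul, abs_of_pos Real.two_pi_pos] at hz
  nlinarith [Real.two_pi_pos]

theorem dslope_exp_ne_zero {z : ℂ} (hz : |z.im| < 2 * Real.pi) : dslope exp 0 z ≠ 0 := by
  rcases eq_or_ne z 0 with rfl | h0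
  · simp
  · rw [dslope_of_ne _ h0, slope_def_field, exp_zero, sub_zero]
    exact div_ne_zero (sub_ne_zero.2 (exp_ne_one_of_abs_im_lt h0 hz)) h0

theorem differentiableAt_bernoulliGen {z : ℂ} (hz : |z.im| < 2 * Real.pi) :
    DifferentiableAt ℂ bernoulliGen z :=
  (differentiable_dslope_exp z).inv (dslope_exp_ne_zero hz)

theorem differentiableOn_limitFactor : DifferentiableOn ℂ limitFactor (halfStrip 3) :=
  DifferentiableOn.deriv
    (fun _ hz => (differentiableAt_bernoulliGen (abs_im_lt_two_pi hz)).differentiableWithinAt)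
    (isOpen_halfStrip 3)

theorem bernoulliGen_neg {z : ℂ} (hz : |z.im| < 2 * Real.pi) :
    bernoulliGen (-z) = bernoulliGen z + z := by
  rcases eq_or_ne z 0 with rfl | h0
  · simp
  have hexp : exp z - 1 ≠ 0 := sub_ne_zero.2 (exp_ne_one_of_abs_im_lt h0 hz)
  have hinv : exp (-z) - 1 = -(exp z - 1) / exp z := by
    rw [exp_neg]; field_simp [exp_ne_zero z]; ring
  rw [bernoulliGen_of_ne h0, bernoulliGen_of_ne (neg_ne_zero.2 h0), hinv]
  field_simp [exp_ne_zero z]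
  ring

-- Differentiate `bernoulliGen (-z) = bernoulliGen z + z` at `0`.
theorem limitFactor_zero : limitFactor 0 = -1 / 2 := by
  have hderiv : HasDerivAt bernoulliGen (limitFactor 0) 0 :=
    (differentiableAt_bernoulliGen (by simp [Real.pi_pos])).hasDerivAt
  have hneg : deriv (fun z => bernoulliGen (-z)) 0 = -limitFactor 0 := by
    rw [deriv_comp_neg, neg_zero, limitFactor]
  have hadd : HasDerivAt (fun z => bernoulliGen (-z)) (limitFactor 0 + 1) 0 := by
    refine (hderiv.add (hasDerivAt_id 0)).congr_of_eventuallyEq ?_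
    filter_upwards [(isOpen_halfStrip 3).mem_nhds (x := 0) (by simp [halfStrip])] with z hz
    exact bernoulliGen_neg (abs_im_lt_two_pi hz)
  linear_combination (1 / 2) * (hneg - hadd.deriv)

theorem measurable_kernelFactor (c : ℝ) : Measurable (kernelFactor c) :=
  Measurable.ite (measurableSet_singleton 0) measurable_const (by fun_prop)

theorem measurable_limitFactor : Measurable limitFactor := measurable_deriv _

theorem kernelFactor_div_one_sub {c : ℝ} (hc0 : c ≠ 0) (hc1 : c ≠ 1) (x : ℂ) :
    kernelFactor c x / (1 - c) = dslope bernoulliGen x (c * x) := by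
  have hc0' : (c : ℂ) ≠ 0 := ofReal_ne_zero.2 hc0
  have hc1' : (c : ℂ) - 1 ≠ 0 := sub_ne_zero.2 (mod_cast hc1)
  rw [← neg_sub (c : ℂ) 1]
  rcases eq_or_ne x 0 with rfl | hx
  · rw [mul_zero, dslope_same, ← limitFactor, limitFactor_zero, kernelFactor, if_pos rfl]
    field_simp
  · have hsub : (c : ℂ) * x - x = (c - 1) * x := by ring
    have hne : (c : ℂ) * x ≠ x := sub_ne_zero.1 (hsub ▸ mul_ne_zero hc1' hx)
    rw [dslope_of_ne _ hne, slope_def_field, hsub, bernoulliGen_of_ne hx,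
      bernoulliGen_of_ne (mul_ne_zero hc0' hx), kernelFactor, if_neg hx]
    field_simp
    ring

theorem tendsto_kernelFactor_div_one_sub {x : ℂ} (hx : |x.im| < 2 * Real.pi) :
    Tendsto (fun c : ℝ => kernelFactor c x / (1 - c)) (𝓝[≠] 1) (𝓝 (limitFactor x)) := by
  have hdslope : Tendsto (dslope bernoulliGen x) (𝓝 x) (𝓝 (limitFactor x)) := by
    rw [limitFactor, ← dslope_same]
    exact continuousAt_dslope_same.2 (differentiableAt_bernoulliGen hx)
  have hmul : Tendsto (fun c : ℝ => (c : ℂ) * x) (𝓝[≠] 1) (𝓝 x) := by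
    have : Continuous fun c : ℝ => (c : ℂ) * x := by fun_prop
    simpa using (this.tendsto 1).mono_left nhdsWithin_le_nhds
  refine (hdslope.comp hmul).congr' ?_
  filter_upwards [self_mem_nhdsWithin,
    eventually_nhdsWithin_of_eventually_nhds (eventually_ne_nhds one_ne_zero)] with c hc1 hc0
  exact (kernelFactor_div_one_sub hc0 hc1 x).symm

theorem norm_bernoulliGen_le_of_one_le_re {z : ℂ} (hz : 1 ≤ z.re) (him : |z.im| ≤ 3) :
    ‖bernoulliGen z‖ ≤ 24 * Real.exp (-z.re / 2) := by
  have h0 : z ≠ 0 := by rintro rfl; norm_num at hz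
  have denominator_ge : Real.exp z.re / 2 ≤ ‖exp z - 1‖ := by
    have := norm_sub_norm_le (exp z) 1
    rw [norm_exp, norm_one] at this
    linarith [Real.add_one_le_exp z.re]
  have numerator_le : ‖z‖ ≤ 12 * Real.exp (z.re / 2) := by
    have := norm_le_abs_re_add_abs_im z
    rw [abs_of_pos (by linarith)] at this
    linarith [Real.add_one_le_exp (z.re / 2)]
  rw [bernoulliGen_of_ne h0, norm_div]
  calc ‖z‖ / ‖exp z - 1‖
      ≤ 12 * Real.exp (z.re / 2) / (Real.exp z.re / 2) := by gcongr
    _ = 24 * (Real.exp (z.re / 2) / Real.exp z.re) := by ring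
    _ = 24 * Real.exp (-z.re / 2) := by rw [← Real.exp_sub]; ring_nf

theorem exists_norm_bernoulliGen_le :
    ∃ K, 0 < K ∧ ∀ z ∈ halfStrip 3, ‖bernoulliGen z‖ ≤ K * Real.exp (-z.re / 2) := by
  have hcompact : IsCompact (Set.Icc (-3 : ℝ) 1 ×ℂ Set.Icc (-3 : ℝ) 3) :=
    isCompact_Icc.reProdIm isCompact_Icc
  obtain ⟨C, hC⟩ := hcompact.exists_bound_of_continuousOn (f := bernoulliGen) fun z hz =>
    (differentiableAt_bernoulliGen ((abs_le.2 hz.2).trans_lt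
      (by linarith [Real.pi_gt_three]))).continuousAt.continuousWithinAt
  refine ⟨max (C * Real.exp (1 / 2)) 24, by positivity, fun z hz => ?_⟩
  rcases le_total z.re 1 with hre | hre
  · have hzC := hC z ⟨⟨hz.1.le, hre⟩, abs_le.1 hz.2.le⟩
    have hC0 : 0 ≤ C := (norm_nonneg _).trans hzC
    calc ‖bernoulliGen z‖ ≤ C * 1 := by rwa [mul_one]
      _ ≤ C * Real.exp (1 / 2 + -z.re / 2) := by gcongr; exact Real.one_le_exp (by linarith)
      _ = C * Real.exp (1 / 2) * Real.exp (-z.re / 2) := by rw [Real.exp_add, mul_assoc]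
      _ ≤ _ := by gcongr; exact le_max_left _ _
  · exact (norm_bernoulliGen_le_of_one_le_re hre hz.2.le).trans (by gcongr; exact le_max_right _ _)

theorem closedBall_one_subset_halfStrip {z : ℂ} {δ : ℝ} (hz : z ∈ halfStrip δ) :
    Metric.closedBall z 1 ⊆ halfStrip (δ + 1) := by
  intro w hw
  rw [Metric.mem_closedBall, dist_eq_norm] at hw
  have hre := abs_le.1 ((abs_re_le_norm (w - z)).trans hw)
  have him := (abs_im_le_norm (w - z)).trans hw
  refine ⟨by rw [sub_re] at hre; linarith [hz.1], ?_⟩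
  calc |w.im| = |z.im + (w - z).im| := by rw [sub_im, add_sub_cancel]
    _ ≤ |z.im| + |(w - z).im| := abs_add_le _ _
    _ < δ + 1 := add_lt_add_of_lt_of_le hz.2 him

theorem exists_norm_limitFactor_le :
    ∃ K, 0 < K ∧ ∀ z ∈ halfStrip 2, ‖limitFactor z‖ ≤ K * Real.exp (-z.re / 2) := by
  obtain ⟨K, hK, hbound⟩ := exists_norm_bernoulliGen_le
  refine ⟨K * Real.exp (1 / 2), by positivity, fun z hz => ?_⟩
  have hball : Metric.closedBall z 1 ⊆ halfStrip 3 :=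
    (closedBall_one_subset_halfStrip hz).trans (halfStrip_mono (by norm_num))
  have hdiff : DiffContOnCl ℂ bernoulliGen (Metric.ball z 1) := by
    refine DifferentiableOn.diffContOnCl fun w hw => ?_
    rw [closure_ball _ one_ne_zero] at hw
    exact (differentiableAt_bernoulliGen (abs_im_lt_two_pi (hball hw))).differentiableWithinAt
  rw [← div_one (K * _ * _)]
  refine norm_deriv_le_of_forall_mem_sphere_norm_le one_pos hdiff fun w hw => ?_
  refine (hbound w (hball (Metric.sphere_subset_closedBall hw))).trans ?_
  have hre := (abs_le.1 ((abs_re_le_norm (w - z)).trans (mem_sphere_iff_norm.1 hw).le)).1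
  rw [sub_re] at hre
  rw [mul_assoc, ← Real.exp_add]
  gcongr
  linarith

theorem norm_dslope_le_of_norm_deriv_le {𝕜 E : Type*} [RCLike 𝕜] [NormedAddCommGroup E]
    [NormedSpace 𝕜 E] {f : 𝕜 → E} {s : Set 𝕜} {C : ℝ} {x y : 𝕜}
    (hf : ∀ z ∈ s, DifferentiableAt 𝕜 f z) (hC : ∀ z ∈ s, ‖deriv f z‖ ≤ C)
    (hs : Convex ℝ s) (hx : x ∈ s) (hy : y ∈ s) : ‖dslope f x y‖ ≤ C := by
  rcases eq_or_ne y x with rfl | hne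
  · rw [dslope_same]; exact hC _ hx
  · rw [dslope_of_ne _ hne, slope_def_module, norm_smul, norm_inv,
      inv_mul_le_iff₀ (norm_pos_iff.2 (sub_ne_zero.2 hne)), mul_comm]
    exact hs.norm_image_sub_le_of_norm_deriv_le hf hC hx hy

theorem exists_norm_dslope_bernoulliGen_le :
    ∃ K, 0 < K ∧ ∀ c ∈ Set.Icc (1 / 2 : ℝ) 2, ∀ x ∈ halfStrip 1,
      ‖dslope bernoulliGen x (c * x)‖ ≤ K * decay x := by
  obtain ⟨K, hK, hbound⟩ := exists_norm_limitFactor_le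
  refine ⟨K * Real.exp 1, by positivity, fun c hc x hx => ?_⟩
  have hmem : ∀ a ∈ Set.Icc (1 / 2 : ℝ) 2, (a : ℂ) * x ∈ halfStrip 2 := fun a ha =>
    halfStrip_mono (by linarith [ha.2])
      (ofReal_mul_mem_halfStrip (by linarith [ha.1] : (0 : ℝ) < a) hx)
  have hexp : ∀ a ∈ Set.Icc (1 / 2 : ℝ) 2, -((a : ℂ) * x).re / 2 ≤ 1 + -x.re / 4 := by
    intro a ha
    rw [re_ofReal_mul]
    nlinarith [hx.1, mul_nonneg (sub_nonneg.2 ha.1) (by linarith [hx.1] : 0 ≤ x.re + 1), ha.2]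
  have hconvex : Convex ℝ ((fun a : ℝ => (a : ℂ) * x) '' Set.Icc (1 / 2) 2) :=
    (convex_Icc _ _).is_linear_image
      ⟨fun a b => by push_cast; ring, fun a b => by simp [mul_assoc]⟩
  refine norm_dslope_le_of_norm_deriv_le ?_ ?_ hconvex ⟨1, by norm_num, by simp⟩ ⟨c, hc, rfl⟩
  · rintro _ ⟨a, ha, rfl⟩
    exact differentiableAt_bernoulliGen
      (abs_im_lt_two_pi (halfStrip_mono (by norm_num) (hmem a ha)))
  · rintro _ ⟨a, ha, rfl⟩
    refine (hbound _ (hmem a ha)).trans ?_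
    rw [decay, mul_assoc, ← Real.exp_add]
    gcongr
    exact hexp a ha

/-! ### Iterated integrals along weighted curves -/

/-- A parametrized curve in `D ⊆ ℂ` with a complex weight (`t ^ (s - 1) dt` in the application),
along which the gauge `b` is integrable. It makes the two contours that are exchanged, the Hankel
contour and the positive real axis, instances of one notion. -/
structure WeightedCurve (D : Set ℂ) (b : ℂ → ℝ) where
  measure : Measure ℝ
  sigmaFinite : SigmaFinite measure
  point : ℝ → ℂ
  weight : ℝ → ℂ
  measurable_point : Measurable point
  measurable_weight : Measurable weight
  ae_point_mem : ∀ᵐ u ∂measure, point u ∈ D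
  integrable_gauge : Integrable (fun u => b (point u) * ‖weight u‖) measure

namespace WeightedCurve

attribute [instance] WeightedCurve.sigmaFinite

variable {D : Set ℂ} {b : ℂ → ℝ}

/-- The weighted integral of `f` along the curve. -/
def integral (γ : WeightedCurve D b) (f : ℂ → ℂ) : ℂ :=
  ∫ u, f (γ.point u) * γ.weight u ∂γ.measure

theorem integrable (γ : WeightedCurve D b) {f : ℂ → ℂ} {K : ℝ} (hf : Measurable f)
    (hK : ∀ z ∈ D, ‖f z‖ ≤ K * b z) :
    Integrable (fun u => f (γ.point u) * γ.weight u) γ.measure := by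
  refine (γ.integrable_gauge.const_mul K).mono'
    ((hf.comp γ.measurable_point).mul γ.measurable_weight).aestronglyMeasurable ?_
  filter_upwards [γ.ae_point_mem] with u hu
  rw [norm_mul, ← mul_assoc]
  gcongr
  exact hK _ hu

variable {r : ℕ}

/-- The product measure of an `r`-tuple of curves. -/
abbrev piMeasure (γ : Fin r → WeightedCurve D b) : Measure (Fin r → ℝ) :=
  Measure.pi fun k => (γ k).measure

/-- The integrand of `piIntegral`. -/
def piIntegrand (γ : Fin r → WeightedCurve D b) (G : (Fin r → ℂ) → ℂ) (u : Fin r → ℝ) : ℂ :=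
  G (fun k => (γ k).point (u k)) * ∏ k, (γ k).weight (u k)

/-- The weighted integral of `G` over the product of the curves `γ 0, …, γ (r - 1)`. -/
def piIntegral (γ : Fin r → WeightedCurve D b) (G : (Fin r → ℂ) → ℂ) : ℂ :=
  ∫ u, piIntegrand γ G u ∂piMeasure γ

theorem ae_forall_point_mem (γ : Fin r → WeightedCurve D b) :
    ∀ᵐ u ∂piMeasure γ, ∀ k, (γ k).point (u k) ∈ D :=
  eventually_all.2 fun k => (Measure.tendsto_eval_ae_ae (μ := fun k => (γ k).measure)
    (i := k)).eventually (γ k).ae_point_mem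

theorem measurable_piIntegrand (γ : Fin r → WeightedCurve D b) {G : (Fin r → ℂ) → ℂ}
    (hG : Measurable G) : Measurable (piIntegrand γ G) :=
  (hG.comp (measurable_pi_lambda _ fun k =>
    (γ k).measurable_point.comp (measurable_pi_apply k))).mul
    (Finset.measurable_prod _ fun k _ => (γ k).measurable_weight.comp (measurable_pi_apply k))

theorem integrable_prod_gauge (γ : Fin r → WeightedCurve D b) :
    Integrable (fun u => ∏ k, b ((γ k).point (u k)) * ‖(γ k).weight (u k)‖) (piMeasure γ) :=
  Integrable.fintype_prod_dep fun k => (γ k).integrable_gauge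

theorem norm_piIntegrand_le (γ : Fin r → WeightedCurve D b) {G : (Fin r → ℂ) → ℂ} {K : ℝ}
    (hK : ∀ t, (∀ k, t k ∈ D) → ‖G t‖ ≤ K * ∏ k, b (t k)) :
    ∀ᵐ u ∂piMeasure γ,
      ‖piIntegrand γ G u‖ ≤ K * ∏ k, b ((γ k).point (u k)) * ‖(γ k).weight (u k)‖ := by
  filter_upwards [ae_forall_point_mem γ] with u hu
  rw [piIntegrand, norm_mul, norm_prod, Finset.prod_mul_distrib, ← mul_assoc]
  gcongr
  exact hK _ hu

theorem integrable_piIntegrand (γ : Fin r → WeightedCurve D b) {G : (Fin r → ℂ) → ℂ} {K : ℝ}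
    (hG : Measurable G) (hK : ∀ t, (∀ k, t k ∈ D) → ‖G t‖ ≤ K * ∏ k, b (t k)) :
    Integrable (piIntegrand γ G) (piMeasure γ) :=
  ((integrable_prod_gauge γ).const_mul K).mono'
    (measurable_piIntegrand γ hG).aestronglyMeasurable (norm_piIntegrand_le γ hK)

theorem tendsto_piIntegral {ι : Type*} {l : Filter ι} [l.IsCountablyGenerated]
    (γ : Fin r → WeightedCurve D b) {G : ι → (Fin r → ℂ) → ℂ} {G' : (Fin r → ℂ) → ℂ} {K : ℝ}
    (hG : ∀ i, Measurable (G i))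
    (hK : ∀ᶠ i in l, ∀ t, (∀ k, t k ∈ D) → ‖G i t‖ ≤ K * ∏ k, b (t k))
    (hlim : ∀ t, (∀ k, t k ∈ D) → Tendsto (fun i => G i t) l (𝓝 (G' t))) :
    Tendsto (fun i => piIntegral γ (G i)) l (𝓝 (piIntegral γ G')) := by
  refine tendsto_integral_filter_of_dominated_convergence
    (fun u => K * ∏ k, b ((γ k).point (u k)) * ‖(γ k).weight (u k)‖)
    (.of_forall fun i => (measurable_piIntegrand γ (hG i)).aestronglyMeasurable)
    (hK.mono fun i hi => norm_piIntegrand_le γ hi) ((integrable_prod_gauge γ).const_mul K) ?_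
  filter_upwards [ae_forall_point_mem γ] with u hu
  exact (hlim _ hu).mul_const _

theorem piIntegrand_insertNth (k : Fin (r + 1)) (γ : Fin (r + 1) → WeightedCurve D b)
    (G : (Fin (r + 1) → ℂ) → ℂ) (x : ℝ) (v : Fin r → ℝ) :
    piIntegrand γ G (k.insertNth x v) =
      G (k.insertNth ((γ k).point x) fun j => (γ (k.succAbove j)).point (v j)) *
        (γ k).weight x * ∏ j, (γ (k.succAbove j)).weight (v j) := by
  have hpoint : (fun i => (γ i).point (k.insertNth (α := fun _ => ℝ) x v i)) =
      k.insertNth ((γ k).point x) fun j => (γ (k.succAbove j)).point (v j) := by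
    ext i
    cases i using k.succAboveCases <;> simp
  rw [piIntegrand, hpoint, Fin.prod_univ_succAbove _ k]
  simp only [Fin.insertNth_apply_same, Fin.insertNth_apply_succAbove, mul_assoc]

theorem piIntegral_eq_integral_integral (k : Fin (r + 1)) (γ : Fin (r + 1) → WeightedCurve D b)
    {G : (Fin (r + 1) → ℂ) → ℂ} (hG : Integrable (piIntegrand γ G) (piMeasure γ)) :
    piIntegral γ G = ∫ v, (γ k).integral
      (fun z => G (k.insertNth z fun j => (γ (k.succAbove j)).point (v j))) *
        ∏ j, (γ (k.succAbove j)).weight (v j) ∂piMeasure fun j => γ (k.succAbove j) := by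
  have hmp := (measurePreserving_piFinSuccAbove (fun i => (γ i).measure) k).symm
  rw [piIntegral, ← hmp.integral_comp', integral_prod_symm]
  · refine integral_congr_ae (.of_forall fun v => ?_)
    simp only [integral, ← integral_mul_const]
    exact integral_congr_ae (.of_forall fun x => piIntegrand_insertNth k γ G x v)
  · exact (hmp.integrable_comp_emb (MeasurableEquiv.measurableEmbedding _)).2 hG

theorem piIntegral_update (γ : Fin r → WeightedCurve D b) (k : Fin r) (β : WeightedCurve D b)
    {G : (Fin r → ℂ) → ℂ} {K : ℝ} {a : ℂ} (hG : Measurable G)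
    (hK : ∀ t, (∀ i, t i ∈ D) → ‖G t‖ ≤ K * ∏ i, b (t i))
    (ha : ∀ t, (∀ i ≠ k, t i ∈ D) → β.integral (fun z => G (Function.update t k z)) =
      a * (γ k).integral fun z => G (Function.update t k z)) :
    piIntegral (Function.update γ k β) G = a * piIntegral γ G := by
  obtain _ | r := r
  · exact k.elim0
  rw [piIntegral_eq_integral_integral k _ (integrable_piIntegrand _ hG hK),
    piIntegral_eq_integral_integral k _ (integrable_piIntegrand _ hG hK), ← integral_const_mul]
  simp only [Function.update_self, Function.update_of_ne (Fin.succAbove_ne k _)]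
  refine integral_congr_ae ?_
  filter_upwards [ae_forall_point_mem fun j => γ (k.succAbove j)] with v hv
  have hchange := ha (k.insertNth (α := fun _ => ℂ) 0 fun j => (γ (k.succAbove j)).point (v j))
    fun i hi => by
      obtain ⟨j, rfl⟩ := Fin.exists_succAbove_eq hi
      rw [Fin.insertNth_apply_succAbove]
      exact hv j
  simp only [Fin.update_insertNth] at hchange
  rw [hchange, mul_assoc]

theorem piIntegral_eq_prod_mul_piIntegral (γ γ' : Fin r → WeightedCurve D b)
    {G : (Fin r → ℂ) → ℂ} {K : ℝ} {a : Fin r → ℂ} (hG : Measurable G)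
    (hK : ∀ t, (∀ i, t i ∈ D) → ‖G t‖ ≤ K * ∏ i, b (t i))
    (ha : ∀ k t, (∀ i ≠ k, t i ∈ D) → (γ k).integral (fun z => G (Function.update t k z)) =
      a k * (γ' k).integral fun z => G (Function.update t k z)) :
    piIntegral γ G = (∏ k, a k) * piIntegral γ' G := by
  suffices h : ∀ S : Finset (Fin r),
      piIntegral (S.piecewise γ γ') G = (∏ k ∈ S, a k) * piIntegral γ' G by
    simpa using h Finset.univ
  intro S
  induction S using Finset.induction_on with
  | empty => simp
  | insert k S hk ih =>
    rw [Finset.piecewise_insert, piIntegral_update (a := a k) _ _ _ hG hK fun t ht => ?_, ih,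
      Finset.prod_insert hk, mul_assoc]
    rw [Finset.piecewise_eq_of_notMem _ _ _ hk]
    exact ha k t ht

end WeightedCurve

/-! ### Collapsing the Hankel contour onto the positive real axis -/

/-- The factor `t ^ (s - 1) dt/du` along the Hankel contour of radius `ε`. -/
def hankelWeight (ε : ℝ) (s : ℂ) (u : ℝ) : ℂ :=
  exp ((s - 1) * hankelLog ε u) * hankelVelocity ε u

theorem cpow_sub_one_eq_exp {x : ℝ} (hx : 0 < x) (s : ℂ) :
    (x : ℂ) ^ (s - 1) = exp ((s - 1) * Real.log x) := by
  rw [cpow_def_of_ne_zero (ofReal_ne_zero.2 hx.ne'), ofReal_log hx.le, mul_comm]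

theorem hankelPoint_of_neg {ε u : ℝ} (hu : u < 0) : hankelPoint ε u = (ε - u : ℝ) := by
  simp [hankelPoint, hankelRadius, hankelArg, hu]

theorem hankelWeight_of_neg {ε u : ℝ} (hε : 0 < ε) (s : ℂ) (hu : u < 0) :
    hankelWeight ε s u = -((ε - u : ℝ) : ℂ) ^ (s - 1) := by
  rw [cpow_sub_one_eq_exp (by linarith : 0 < ε - u)]
  simp [hankelWeight, hankelLog, hankelVelocity, hankelRadius, hankelArg, hu]

theorem hankelPoint_of_two_pi_lt {ε u : ℝ} (hu : 2 * Real.pi < u) :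
    hankelPoint ε u = (ε - 2 * Real.pi + u : ℝ) := by
  have h0 : ¬u < 0 := by linarith [Real.pi_pos]
  simp only [hankelPoint, hankelRadius, hankelArg, h0, hu.not_ge, if_false]
  push_cast
  rw [exp_two_pi_mul_I]
  ring

theorem hankelWeight_of_two_pi_lt {ε u : ℝ} (hε : 0 < ε) (s : ℂ) (hu : 2 * Real.pi < u) :
    hankelWeight ε s u =
      exp (2 * Real.pi * I * s) * ((ε - 2 * Real.pi + u : ℝ) : ℂ) ^ (s - 1) := by
  have h0 : ¬u < 0 := by linarith [Real.pi_pos]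
  rw [cpow_sub_one_eq_exp (by linarith : 0 < ε - 2 * Real.pi + u),
    sub_add_eq_add_sub, add_sub_assoc]
  simp only [hankelWeight, hankelLog, hankelVelocity, hankelRadius, hankelArg, h0, hu.not_ge,
    if_false, mul_one, ← exp_add]
  exact exp_eq_exp_iff_exists_int.2 ⟨-1, by push_cast; ring⟩

theorem exp_log_add_mul_I {ε : ℝ} (hε : 0 < ε) (u : ℝ) :
    exp (Real.log ε + u * I) = ε * exp (u * I) := by
  rw [exp_add, ← ofReal_exp, Real.exp_log hε]

theorem hankelPoint_of_mem_Icc {ε u : ℝ} (hε : 0 < ε) (hu : u ∈ Set.Icc 0 (2 * Real.pi)) :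
    hankelPoint ε u = exp (Real.log ε + u * I) := by
  rw [exp_log_add_mul_I hε]
  simp [hankelPoint, hankelRadius, hankelArg, hu.1.not_gt, hu.2]

theorem hankelWeight_of_mem_Icc {ε u : ℝ} (hε : 0 < ε) (s : ℂ)
    (hu : u ∈ Set.Icc 0 (2 * Real.pi)) :
    hankelWeight ε s u = exp (s * (Real.log ε + u * I)) * I := by
  simp only [hankelWeight, hankelLog, hankelVelocity, hankelRadius, hankelArg, hu.1.not_gt, hu.2,
    if_false, if_true]
  rw [mul_assoc I, ← exp_log_add_mul_I hε, mul_left_comm, ← exp_add, mul_comm]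
  ring_nf

theorem measurable_hankelRadius (ε : ℝ) : Measurable (hankelRadius ε) :=
  Measurable.ite measurableSet_Iio (by fun_prop)
    (Measurable.ite measurableSet_Iic (by fun_prop) (by fun_prop))

theorem measurable_hankelArg : Measurable hankelArg :=
  Measurable.ite measurableSet_Iio (by fun_prop)
    (Measurable.ite measurableSet_Iic (by fun_prop) (by fun_prop))

theorem measurable_hankelVelocity (ε : ℝ) : Measurable (hankelVelocity ε) :=
  Measurable.ite measurableSet_Iio (by fun_prop)
    (Measurable.ite measurableSet_Iic (by fun_prop) (by fun_prop))

theorem measurable_hankelPoint (ε : ℝ) : Measurable (hankelPoint ε) := by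
  have := measurable_hankelRadius ε
  have := measurable_hankelArg
  unfold hankelPoint
  fun_prop

theorem measurable_hankelWeight (ε : ℝ) (s : ℂ) : Measurable (hankelWeight ε s) := by
  have := measurable_hankelRadius ε
  have := measurable_hankelArg
  have := measurable_hankelVelocity ε
  unfold hankelWeight hankelLog
  fun_prop

theorem exp_mem_halfStrip {δ : ℝ} {w : ℂ} (h : Real.exp w.re < δ) : exp w ∈ halfStrip δ := by
  rw [← norm_exp] at h
  exact ⟨by linarith [(abs_le.1 (abs_re_le_norm (exp w))).1], (abs_im_le_norm _).trans_lt h⟩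

theorem exp_log_add_mul_I_mem_halfStrip {δ ε : ℝ} (hε : 0 < ε) (hεδ : ε < δ) (u : ℝ) :
    exp (Real.log ε + u * I) ∈ halfStrip δ :=
  exp_mem_halfStrip (by simpa [Real.exp_log hε] using hεδ)

theorem hankelPoint_mem_halfStrip {δ ε : ℝ} (hε : 0 < ε) (hεδ : ε < δ) (u : ℝ) :
    hankelPoint ε u ∈ halfStrip δ := by
  rcases lt_or_ge u 0 with hneg | hnonneg
  · rw [hankelPoint_of_neg hneg]
    exact ofReal_mem_halfStrip (hε.trans hεδ) (by linarith)
  rcases lt_or_ge (2 * Real.pi) u with hgt | hle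
  · rw [hankelPoint_of_two_pi_lt hgt]
    exact ofReal_mem_halfStrip (hε.trans hεδ) (by linarith)
  · rw [hankelPoint_of_mem_Icc hε ⟨hnonneg, hle⟩]
    exact exp_log_add_mul_I_mem_halfStrip hε hεδ u

theorem measurePreserving_const_sub_Iio (ε : ℝ) :
    MeasurePreserving (fun u => ε - u) (volume.restrict (Set.Iio 0))
      (volume.restrict (Set.Ioi ε)) := by
  simpa using (Measure.measurePreserving_sub_left volume ε).restrict_preimage_emb
    (MeasurableEquiv.subLeft ε).measurableEmbedding (Set.Ioi ε)

theorem measurePreserving_const_sub_add_Ioi (ε a : ℝ) :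
    MeasurePreserving (fun u => ε - a + u) (volume.restrict (Set.Ioi a))
      (volume.restrict (Set.Ioi ε)) := by
  simpa using (measurePreserving_add_left volume (ε - a)).restrict_preimage_emb
    (MeasurableEquiv.addLeft (ε - a)).measurableEmbedding (Set.Ioi ε)

theorem integrableOn_decay_mul_norm_cpow {s : ℂ} (hs : 0 < s.re) :
    IntegrableOn (fun x : ℝ => decay x * ‖(x : ℂ) ^ (s - 1)‖) (Set.Ioi 0) := by
  refine (integrableOn_rpow_mul_exp_neg_mul_rpow (p := 1) (s := s.re - 1) (b := 1 / 4)
    (by linarith) one_pos (by norm_num)).congr_fun (fun x hx => ?_) measurableSet_Ioi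
  simp only [norm_cpow_eq_rpow_re_of_pos hx, decay, ofReal_re, sub_re, one_re, Real.rpow_one]
  ring_nf

theorem integrable_decay_mul_norm_hankelWeight {s : ℂ} (hs : 0 < s.re) {ε : ℝ} (hε : 0 < ε) :
    Integrable fun u : ℝ => decay (hankelPoint ε u) * ‖hankelWeight ε s u‖ := by
  have hray : IntegrableOn (fun x : ℝ => decay x * ‖(x : ℂ) ^ (s - 1)‖) (Set.Ioi ε) :=
    (integrableOn_decay_mul_norm_cpow hs).mono_set (Set.Ioi_subset_Ioi hε.le)
  rw [← integrableOn_univ, ← Set.Iio_union_Ici (a := (0 : ℝ)),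
    ← Set.Icc_union_Ioi_eq_Ici Real.two_pi_pos.le]
  refine .union ?_ (.union ?_ ?_)
  · refine (((measurePreserving_const_sub_Iio ε).integrable_comp_emb
      (MeasurableEquiv.subLeft ε).measurableEmbedding).2 hray).congr ?_
    filter_upwards [ae_restrict_mem measurableSet_Iio] with u hu
    rw [hankelPoint_of_neg hu, hankelWeight_of_neg hε s hu, norm_neg, Function.comp_apply]
  · have hcont : Continuous fun u : ℝ =>
        decay (exp (Real.log ε + u * I)) * ‖exp (s * (Real.log ε + u * I)) * I‖ := by
      unfold decay
      fun_prop
    refine hcont.continuousOn.integrableOn_Icc.congr_fun (fun u hu => ?_) measurableSet_Icc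
    simp only [hankelPoint_of_mem_Icc hε hu, hankelWeight_of_mem_Icc hε s hu]
  · refine ((((measurePreserving_const_sub_add_Ioi ε (2 * Real.pi)).integrable_comp_emb
      (MeasurableEquiv.addLeft _).measurableEmbedding).2 hray).const_mul
        ‖exp (2 * Real.pi * I * s)‖).congr ?_
    filter_upwards [ae_restrict_mem measurableSet_Ioi] with u hu
    rw [hankelPoint_of_two_pi_lt hu, hankelWeight_of_two_pi_lt hε s hu, norm_mul,
      Function.comp_apply, mul_left_comm]

/-- The Hankel contour of radius `ε` with the weight `t ^ (s - 1) dt`. -/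
def hankelCurve {δ ε : ℝ} (hε : 0 < ε) (hεδ : ε < δ) {s : ℂ} (hs : 0 < s.re) :
    WeightedCurve (halfStrip δ) decay where
  measure := volume
  sigmaFinite := inferInstance
  point := hankelPoint ε
  weight := hankelWeight ε s
  measurable_point := measurable_hankelPoint ε
  measurable_weight := measurable_hankelWeight ε s
  ae_point_mem := ae_of_all _ (hankelPoint_mem_halfStrip hε hεδ)
  integrable_gauge := integrable_decay_mul_norm_hankelWeight hs hε

/-- The positive real axis with the weight `x ^ (s - 1) dx`. -/
def rayCurve {δ : ℝ} (hδ : 0 < δ) {s : ℂ} (hs : 0 < s.re) :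
    WeightedCurve (halfStrip δ) decay where
  measure := volume.restrict (Set.Ioi 0)
  sigmaFinite := inferInstance
  point x := x
  weight x := (x : ℂ) ^ (s - 1)
  measurable_point := measurable_ofReal
  measurable_weight := measurable_ofReal.pow_const _
  ae_point_mem := (ae_restrict_mem measurableSet_Ioi).mono fun _ hx => ofReal_mem_halfStrip hδ hx
  integrable_gauge := integrableOn_decay_mul_norm_cpow hs

theorem setIntegral_hankel_Iio {ε : ℝ} (hε : 0 < ε) (f : ℂ → ℂ) (s : ℂ) :
    ∫ u in Set.Iio 0, f (hankelPoint ε u) * hankelWeight ε s u =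
      -∫ x in Set.Ioi ε, f x * (x : ℂ) ^ (s - 1) := by
  rw [← integral_neg, ← (measurePreserving_const_sub_Iio ε).integral_comp
    (MeasurableEquiv.subLeft ε).measurableEmbedding]
  refine setIntegral_congr_fun measurableSet_Iio fun u hu => ?_
  simp only [hankelPoint_of_neg hu, hankelWeight_of_neg hε s hu, mul_neg]

theorem setIntegral_hankel_Ioi {ε : ℝ} (hε : 0 < ε) (f : ℂ → ℂ) (s : ℂ) :
    ∫ u in Set.Ioi (2 * Real.pi), f (hankelPoint ε u) * hankelWeight ε s u =
      exp (2 * Real.pi * I * s) * ∫ x in Set.Ioi ε, f x * (x : ℂ) ^ (s - 1) := by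
  rw [← integral_const_mul, ← (measurePreserving_const_sub_add_Ioi ε (2 * Real.pi)).integral_comp
    (MeasurableEquiv.addLeft _).measurableEmbedding]
  refine setIntegral_congr_fun measurableSet_Ioi fun u hu => ?_
  simp only [hankelPoint_of_two_pi_lt hu, hankelWeight_of_two_pi_lt hε s hu]
  ring

/-- The integral of `f t * t ^ (s - 1) dt` over the circle `|t| = ε`, slit along the positive real
axis, in the logarithmic coordinate `t = e^(log ε + iu)` with `0 ≤ u ≤ 2π`. -/
def circleMellin (f : ℂ → ℂ) (s : ℂ) (ε : ℝ) : ℂ :=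
  ∫ u in (0 : ℝ)..2 * Real.pi,
    f (exp (Real.log ε + u * I)) * (exp (s * (Real.log ε + u * I)) * I)

theorem intervalIntegral_hankel {ε : ℝ} (hε : 0 < ε) (f : ℂ → ℂ) (s : ℂ) :
    ∫ u in (0 : ℝ)..2 * Real.pi, f (hankelPoint ε u) * hankelWeight ε s u =
      circleMellin f s ε := by
  refine intervalIntegral.integral_congr fun u hu => ?_
  rw [Set.uIcc_of_le Real.two_pi_pos.le] at hu
  simp only [hankelPoint_of_mem_Icc hε hu, hankelWeight_of_mem_Icc hε s hu]

section Collapse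

variable {f : ℂ → ℂ} {δ : ℝ}

theorem continuousOn_mul_cpow (hδ : 0 < δ) (hf : ContinuousOn f (halfStrip δ)) (s : ℂ) :
    ContinuousOn (fun x : ℝ => f x * (x : ℂ) ^ (s - 1)) (Set.Ioi 0) :=
  (hf.comp continuous_ofReal.continuousOn fun _ hx => ofReal_mem_halfStrip hδ hx).mul
    fun x hx => (continuousAt_ofReal_cpow_const x _ (Or.inr (ne_of_gt hx))).continuousWithinAt

theorem intervalIntegral_comp_exp_mul_exp (hδ : 0 < δ) (hf : ContinuousOn f (halfStrip δ)) (s : ℂ)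
    {η ε : ℝ} (hη : 0 < η) (hε : 0 < ε) :
    ∫ x in Real.log η..Real.log ε, f (exp x) * exp (s * x) =
      ∫ x in η..ε, f x * (x : ℂ) ^ (s - 1) := by
  have himage : Real.exp '' Set.uIcc (Real.log η) (Real.log ε) ⊆ Set.Ioi 0 := by
    rintro _ ⟨x, -, rfl⟩
    exact Real.exp_pos x
  have hsubst := intervalIntegral.integral_deriv_smul_comp' (a := Real.log η) (b := Real.log ε)
    (fun x _ => Real.hasDerivAt_exp x) Real.continuous_exp.continuousOn
    ((continuousOn_mul_cpow hδ hf s).mono himage)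
  rw [Real.exp_log hη, Real.exp_log hε] at hsubst
  rw [← hsubst]
  refine intervalIntegral.integral_congr fun x _ => ?_
  rw [Function.comp_apply, cpow_sub_one_eq_exp (Real.exp_pos x), Real.log_exp, real_smul,
    mul_left_comm, ofReal_exp, ← exp_add]
  ring_nf

-- Cauchy's theorem on the rectangle `log η ≤ Re w ≤ log ε`, `0 ≤ Im w ≤ 2π` for the integrand in
-- the coordinate `w = log t`, which is holomorphic across the branch cut.
theorem circleMellin_sub_circleMellin (hf : DifferentiableOn ℂ f (halfStrip δ)) {η ε : ℝ}
    (hη : 0 < η) (hηε : η ≤ ε) (hεδ : ε < δ) (s : ℂ) :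
    circleMellin f s ε - circleMellin f s η =
      (exp (2 * Real.pi * I * s) - 1) * ∫ x in η..ε, f x * (x : ℂ) ^ (s - 1) := by
  have hε : 0 < ε := hη.trans_le hηε
  let g : ℂ → ℂ := fun w => f (exp w) * exp (s * w)
  have hg : DifferentiableOn ℂ g
      (Set.uIcc (Real.log η) (Real.log ε) ×ℂ Set.uIcc 0 (2 * Real.pi)) := by
    refine .mul (hf.comp differentiable_exp.differentiableOn fun w hw => ?_) (by fun_prop)
    have hre : w.re ∈ Set.Icc (Real.log η) (Real.log ε) := by
      simpa [Set.uIcc_of_le (Real.log_le_log hη hηε)] using hw.1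
    exact exp_mem_halfStrip (((Real.le_log_iff_exp_le hε).1 hre.2).trans_lt hεδ)
  have hbottom : ∫ x in Real.log η..Real.log ε, g x = ∫ x in η..ε, f x * (x : ℂ) ^ (s - 1) :=
    intervalIntegral_comp_exp_mul_exp (hε.trans hεδ) hf.continuousOn s hη hε
  have htop : ∀ x : ℝ, g (x + (2 * Real.pi : ℝ) * I) = exp (2 * Real.pi * I * s) * g x := by
    intro x
    have hperiod : exp ((x : ℂ) + (2 * Real.pi : ℝ) * I) = exp x := by
      push_cast
      exact exp_periodic x
    simp only [g, hperiod]
    rw [mul_left_comm, ← exp_add]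
    push_cast
    ring_nf
  have hrect := integral_boundary_rect_eq_zero_of_differentiableOn g
    (Real.log η) (Real.log ε + (2 * Real.pi : ℝ) * I) (by simpa using hg)
  simp only [add_re, add_im, mul_re, mul_im, ofReal_re, ofReal_im, I_re, I_im, mul_zero, mul_one,
    sub_zero, zero_add, add_zero, htop, intervalIntegral.integral_const_mul, ofReal_zero, zero_mul,
    smul_eq_mul, hbottom] at hrect
  simp only [circleMellin, ← mul_assoc, intervalIntegral.integral_mul_const]
  linear_combination hrect

theorem norm_circleMellin_le {C η : ℝ} (hC : ∀ z ∈ halfStrip δ, ‖f z‖ ≤ C) (hη : 0 < η)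
    (hηδ : η < δ) (s : ℂ) :
    ‖circleMellin f s η‖ ≤
      C * (η ^ s.re * Real.exp (|s.im| * (2 * Real.pi))) * (2 * Real.pi) := by
  refine (intervalIntegral.norm_integral_le_of_norm_le_const fun u hu => ?_).trans_eq
    (by rw [sub_zero, abs_of_pos Real.two_pi_pos])
  rw [Set.uIoc_of_le Real.two_pi_pos.le] at hu
  have hfC := hC _ (exp_log_add_mul_I_mem_halfStrip hη hηδ u)
  have hC0 : 0 ≤ C := (norm_nonneg _).trans hfC
  have hre : (s * (Real.log η + u * I)).re = Real.log η * s.re + -s.im * u := by simp; ring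
  have him : -s.im * u ≤ |s.im| * (2 * Real.pi) :=
    mul_le_mul (neg_le_abs _) hu.2 hu.1.le (abs_nonneg _)
  rw [norm_mul, norm_mul, norm_I, mul_one, norm_exp, hre, Real.rpow_def_of_pos hη, ← Real.exp_add]
  gcongr

theorem tendsto_circleMellin {C : ℝ} (hδ : 0 < δ) (hC : ∀ z ∈ halfStrip δ, ‖f z‖ ≤ C)
    {s : ℂ} (hs : 0 < s.re) : Tendsto (circleMellin f s) (𝓝[>] 0) (𝓝 0) := by
  have hrpow : Tendsto (fun η : ℝ => η ^ s.re) (𝓝[>] 0) (𝓝 0) := by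
    have := (Real.continuousAt_rpow_const 0 s.re (Or.inr hs.le)).tendsto
    rw [Real.zero_rpow hs.ne'] at this
    exact this.mono_left nhdsWithin_le_nhds
  have hbound := ((hrpow.mul_const (Real.exp (|s.im| * (2 * Real.pi)))).const_mul C).mul_const
    (2 * Real.pi)
  rw [zero_mul, mul_zero, zero_mul] at hbound
  refine squeeze_zero_norm' ?_ hbound
  filter_upwards [Ioo_mem_nhdsGT hδ] with η hη
  exact norm_circleMellin_le hC hη.1 hη.2 s

theorem circleMellin_eq {C ε : ℝ} (hf : DifferentiableOn ℂ f (halfStrip δ))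
    (hC : ∀ z ∈ halfStrip δ, ‖f z‖ ≤ C) (hε : 0 < ε) (hεδ : ε < δ) {s : ℂ} (hs : 0 < s.re)
    (hint : IntegrableOn (fun x : ℝ => f x * (x : ℂ) ^ (s - 1)) (Set.Icc 0 ε)) :
    circleMellin f s ε =
      (exp (2 * Real.pi * I * s) - 1) * ∫ x in (0 : ℝ)..ε, f x * (x : ℂ) ^ (s - 1) := by
  have hprimitive : Tendsto (fun η : ℝ => ∫ x in η..ε, f x * (x : ℂ) ^ (s - 1)) (𝓝[>] 0)
      (𝓝 (∫ x in (0 : ℝ)..ε, f x * (x : ℂ) ^ (s - 1))) := by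
    rw [← Set.uIcc_of_le hε.le] at hint
    have := intervalIntegral.continuousOn_primitive_interval_left hint 0 Set.left_mem_uIcc
    rw [Set.uIcc_of_le hε.le] at this
    rw [← nhdsWithin_Ioc_eq_nhdsGT hε]
    exact this.tendsto.mono_left (nhdsWithin_mono _ Set.Ioc_subset_Icc_self)
  have hcircle := (tendsto_circleMellin (hε.trans hεδ) hC hs).const_sub (circleMellin f s ε)
  rw [sub_zero] at hcircle
  refine tendsto_nhds_unique (hcircle.congr' ?_) (hprimitive.const_mul _)
  filter_upwards [Ioo_mem_nhdsGT hε] with η hη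
  exact circleMellin_sub_circleMellin hf hη.1 hη.2.le hεδ s

theorem integral_hankelCurve {K ε : ℝ} (hm : Measurable f)
    (hf : DifferentiableOn ℂ f (halfStrip δ)) (hK : ∀ z ∈ halfStrip δ, ‖f z‖ ≤ K * decay z)
    (hε : 0 < ε) (hεδ : ε < δ) {s : ℂ} (hs : 0 < s.re) :
    (hankelCurve hε hεδ hs).integral f =
      (exp (2 * Real.pi * I * s) - 1) * (rayCurve (hε.trans hεδ) hs).integral f := by
  have hhankel : Integrable fun u => f (hankelPoint ε u) * hankelWeight ε s u :=
    (hankelCurve hε hεδ hs).integrable hm hK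
  have hray : IntegrableOn (fun x : ℝ => f x * (x : ℂ) ^ (s - 1)) (Set.Ioi 0) :=
    (rayCurve (hε.trans hεδ) hs).integrable hm hK
  have hC : ∀ z ∈ halfStrip δ, ‖f z‖ ≤ |K| * Real.exp (δ / 4) := fun z hz =>
    (hK z hz).trans (by unfold decay; gcongr; exacts [le_abs_self K, by linarith [hz.1]])
  have hcircle := circleMellin_eq hf hC hε hεδ hs
    ((integrableOn_Icc_iff_integrableOn_Ioc enorm_ne_top).2 (hray.mono_set Set.Ioc_subset_Ioi_self))
  change (∫ u, f (hankelPoint ε u) * hankelWeight ε s u) =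
    _ * ∫ x in Set.Ioi (0 : ℝ), f x * (x : ℂ) ^ (s - 1)
  rw [← intervalIntegral.integral_Iio_add_Ici hhankel.integrableOn hhankel.integrableOn,
    integral_Ici_eq_integral_Ioi, ← intervalIntegral.integral_interval_add_Ioi
      hhankel.integrableOn (hhankel.integrableOn (s := Set.Ioi (2 * Real.pi))),
    setIntegral_hankel_Iio hε, setIntegral_hankel_Ioi hε, intervalIntegral_hankel hε, hcircle,
    ← intervalIntegral.integral_interval_add_Ioi hray (hray.mono_set (Set.Ioi_subset_Ioi hε.le))]
  ring

end Collapse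

/-! ### The limit defining the desingularized zeta function -/

/-- The width of a half-strip in which all sums of at most `r` points remain in `halfStrip 1`. -/
def polyWidth (r : ℕ) : ℝ := 1 / (r + 1)

/-- The limit of `kernel r c / (1 - c) ^ r` as `c → 1`. -/
def limitKernel (r : ℕ) (t : Fin r → ℂ) : ℂ := ∏ j : Fin r, limitFactor (∑ k ∈ Finset.Ici j, t k)

/-- The Mellin transform `∏_k Γ(s_k)⁻¹ ∫_{(0,∞)^r} limitKernel r x ∏_k x_k^(s_k - 1) dx_k`, which
represents `desZeta r` on the polyhedron `Re s_k > 0`. -/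
def mellinDes (r : ℕ) (s : Fin r → ℂ) : ℂ :=
  (∏ k, (Gamma (s k))⁻¹) * ∫ x, limitKernel r (fun k => x k) * ∏ k, (x k : ℂ) ^ (s k - 1)
    ∂Measure.pi fun _ : Fin r => volume.restrict (Set.Ioi (0 : ℝ))

theorem polyWidth_pos (r : ℕ) : 0 < polyWidth r := by
  unfold polyWidth
  positivity

theorem sum_mem_halfStrip {ι : Type*} {S : Finset ι} {t : ι → ℂ} {δ : ℝ} (hδ : 0 < δ)
    (ht : ∀ k ∈ S, t k ∈ halfStrip δ) : ∑ k ∈ S, t k ∈ halfStrip ((S.card + 1) * δ) := by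
  classical
  induction S using Finset.induction_on with
  | empty => simpa [halfStrip] using hδ
  | insert k S hk ih =>
    rw [Finset.forall_mem_insert] at ht
    rw [Finset.sum_insert hk, Finset.card_insert_of_notMem hk]
    push_cast
    rw [add_mul _ _ δ, one_mul, add_comm _ δ]
    exact add_mem_halfStrip ht.1 (ih ht.2)

theorem forall_update_mem {ι α : Type*} [DecidableEq ι] {D : Set α} {t : ι → α} {k : ι} {z : α}
    (ht : ∀ i ≠ k, t i ∈ D) (hz : z ∈ D) : ∀ i, Function.update t k z i ∈ D :=
  (Function.forall_update_iff t fun _ w => w ∈ D).2 ⟨hz, ht⟩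

theorem norm_apply_update_le {ι α E : Type*} [Fintype ι] [DecidableEq ι] [Norm E] {D : Set α}
    {b : α → ℝ} {G : (ι → α) → E} {K : ℝ} {t : ι → α} {k : ι} {z : α}
    (hK : ∀ t, (∀ i, t i ∈ D) → ‖G t‖ ≤ K * ∏ i, b (t i)) (ht : ∀ i ≠ k, t i ∈ D) (hz : z ∈ D) :
    ‖G (Function.update t k z)‖ ≤ (K * ∏ i ∈ Finset.univ.erase k, b (t i)) * b z := by
  refine (hK _ (forall_update_mem ht hz)).trans_eq ?_
  rw [← Finset.prod_erase_mul _ _ (Finset.mem_univ k), Function.update_self, ← mul_assoc]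
  congr 2
  refine Finset.prod_congr rfl fun i hi => ?_
  rw [Function.update_of_ne (Finset.ne_of_mem_erase hi)]

section Kernel

variable {r : ℕ} {t : Fin r → ℂ}

theorem sum_mem_halfStrip_one (ht : ∀ i, t i ∈ halfStrip (polyWidth r)) (S : Finset (Fin r)) :
    ∑ k ∈ S, t k ∈ halfStrip 1 := by
  refine halfStrip_mono ?_ (sum_mem_halfStrip (polyWidth_pos r) fun k _ => ht k)
  have hcard : (S.card : ℝ) ≤ r := mod_cast card_finset_fin_le S
  rw [polyWidth, mul_one_div, div_le_one (by positivity)]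
  linarith

theorem re_sub_one_le_re_sum_Ici (ht : ∀ i, t i ∈ halfStrip (polyWidth r)) (j : Fin r) :
    (t j).re - 1 ≤ (∑ k ∈ Finset.Ici j, t k).re := by
  rw [← Finset.add_sum_erase _ _ (Finset.mem_Ici.2 le_rfl), add_re]
  linarith [(sum_mem_halfStrip_one ht ((Finset.Ici j).erase j)).1]

theorem norm_prod_sum_Ici_le {F : ℂ → ℂ} {K : ℝ} (hK : 0 < K)
    (hF : ∀ x ∈ halfStrip 1, ‖F x‖ ≤ K * decay x) (ht : ∀ i, t i ∈ halfStrip (polyWidth r)) :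
    ‖∏ j, F (∑ k ∈ Finset.Ici j, t k)‖ ≤ (K * Real.exp (1 / 4)) ^ r * ∏ i, decay (t i) := by
  have hfactor : ∀ j, ‖F (∑ k ∈ Finset.Ici j, t k)‖ ≤ K * Real.exp (1 / 4) * decay (t j) := by
    intro j
    refine (hF _ (sum_mem_halfStrip_one ht _)).trans ?_
    rw [decay, decay, mul_assoc, ← Real.exp_add]
    gcongr
    linarith [re_sub_one_le_re_sum_Ici ht j]
  calc ‖∏ j, F (∑ k ∈ Finset.Ici j, t k)‖
      ≤ ∏ j, K * Real.exp (1 / 4) * decay (t j) := by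
        rw [norm_prod]
        exact Finset.prod_le_prod (fun _ _ => norm_nonneg _) fun j _ => hfactor j
    _ = (K * Real.exp (1 / 4)) ^ r * ∏ i, decay (t i) := by
        rw [Finset.prod_mul_distrib, Finset.prod_const, Finset.card_univ, Fintype.card_fin]

theorem kernel_div_one_sub_pow (c : ℝ) (t : Fin r → ℂ) :
    kernel r c t / (1 - c) ^ r = ∏ j, kernelFactor c (∑ k ∈ Finset.Ici j, t k) / (1 - c) := by
  rw [kernel, Finset.prod_div_distrib, Finset.prod_const, Finset.card_univ, Fintype.card_fin]

theorem exists_norm_kernel_div_le (r : ℕ) :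
    ∃ K : ℝ, ∀ᶠ c : ℝ in 𝓝[≠] 1, ∀ t : Fin r → ℂ, (∀ i, t i ∈ halfStrip (polyWidth r)) →
      ‖kernel r c t / (1 - c) ^ r‖ ≤ K * ∏ i, decay (t i) := by
  obtain ⟨K, hK, hbound⟩ := exists_norm_dslope_bernoulliGen_le
  refine ⟨(K * Real.exp (1 / 4)) ^ r, ?_⟩
  filter_upwards [self_mem_nhdsWithin, nhdsWithin_le_nhds
    (Icc_mem_nhds (by norm_num : (1 / 2 : ℝ) < 1) one_lt_two)] with c hc1 hc t ht
  have hc0 : c ≠ 0 := (one_half_pos.trans_le hc.1).ne'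
  simp only [kernel_div_one_sub_pow, kernelFactor_div_one_sub hc0 hc1]
  exact norm_prod_sum_Ici_le hK (hbound c hc) ht

theorem exists_norm_limitKernel_le (r : ℕ) :
    ∃ K : ℝ, ∀ t : Fin r → ℂ, (∀ i, t i ∈ halfStrip (polyWidth r)) →
      ‖limitKernel r t‖ ≤ K * ∏ i, decay (t i) := by
  obtain ⟨K, hK, hbound⟩ := exists_norm_dslope_bernoulliGen_le
  refine ⟨(K * Real.exp (1 / 4)) ^ r, fun t ht => norm_prod_sum_Ici_le hK (fun x hx => ?_) ht⟩
  simpa [limitFactor] using hbound 1 (by norm_num) x hx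

theorem tendsto_kernel_div (ht : ∀ i, t i ∈ halfStrip (polyWidth r)) :
    Tendsto (fun c : ℝ => kernel r c t / (1 - c) ^ r) (𝓝[≠] 1) (𝓝 (limitKernel r t)) := by
  simp only [kernel_div_one_sub_pow]
  exact tendsto_finsetProd _ fun j _ => tendsto_kernelFactor_div_one_sub
    (abs_im_lt_two_pi (halfStrip_mono (by norm_num) (sum_mem_halfStrip_one ht _)))

theorem measurable_sum_Ici (j : Fin r) : Measurable fun t : Fin r → ℂ => ∑ k ∈ Finset.Ici j, t k :=
  Finset.measurable_sum _ fun k _ => measurable_pi_apply k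

theorem measurable_kernel (r : ℕ) (c : ℝ) : Measurable (kernel r c) :=
  Finset.measurable_prod _ fun j _ => (measurable_kernelFactor c).comp (measurable_sum_Ici j)

theorem measurable_limitKernel (r : ℕ) : Measurable (limitKernel r) :=
  Finset.measurable_prod _ fun j _ => measurable_limitFactor.comp (measurable_sum_Ici j)

theorem differentiableOn_limitKernel_update {k : Fin r}
    (ht : ∀ i ≠ k, t i ∈ halfStrip (polyWidth r)) :
    DifferentiableOn ℂ (fun z => limitKernel r (Function.update t k z))
      (halfStrip (polyWidth r)) := by
  refine DifferentiableOn.fun_finsetProd fun j _ => differentiableOn_limitFactor.comp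
    (f := fun z => ∑ i ∈ Finset.Ici j, Function.update t k z i) ?_ fun z hz => ?_
  · have : Differentiable ℂ (Function.update t k) := fun z =>
      (hasFDerivAt_update t z).differentiableAt
    fun_prop
  · exact halfStrip_mono (by norm_num) (sum_mem_halfStrip_one (forall_update_mem ht hz) _)

end Kernel

section Limit

variable {r : ℕ} {s : Fin r → ℂ} {ε : ℝ}

theorem hankelIntegral_eq_piIntegral (hs : ∀ k, 0 < (s k).re) (hε : 0 < ε)
    (hεr : ε < polyWidth r) (f : (Fin r → ℂ) → ℂ) :
    hankelIntegral r ε f s = WeightedCurve.piIntegral (fun k => hankelCurve hε hεr (hs k)) f :=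
  rfl

theorem mellinDes_eq_piIntegral (hs : ∀ k, 0 < (s k).re) :
    mellinDes r s = (∏ k, (Gamma (s k))⁻¹) *
      WeightedCurve.piIntegral (fun k => rayCurve (polyWidth_pos r) (hs k)) (limitKernel r) :=
  rfl

theorem integrable_limitKernel_mul_cpow (hs : ∀ k, 0 < (s k).re) :
    Integrable (fun x => limitKernel r (fun k => x k) * ∏ k, (x k : ℂ) ^ (s k - 1))
      (Measure.pi fun _ : Fin r => volume.restrict (Set.Ioi (0 : ℝ))) := by
  obtain ⟨K, hK⟩ := exists_norm_limitKernel_le r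
  exact WeightedCurve.integrable_piIntegrand (fun k => rayCurve (polyWidth_pos r) (hs k))
    (measurable_limitKernel r) hK

theorem hankelIntegral_limitKernel (hs : ∀ k, 0 < (s k).re) (hε : 0 < ε)
    (hεr : ε < polyWidth r) :
    hankelIntegral r ε (limitKernel r) s = (∏ k, (exp (2 * Real.pi * I * s k) - 1)) *
      WeightedCurve.piIntegral (fun k => rayCurve (polyWidth_pos r) (hs k)) (limitKernel r) := by
  obtain ⟨K, hK⟩ := exists_norm_limitKernel_le r
  rw [hankelIntegral_eq_piIntegral hs hε hεr]
  exact WeightedCurve.piIntegral_eq_prod_mul_piIntegral _ _ (measurable_limitKernel r) hK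
    fun k t ht => integral_hankelCurve
      ((measurable_limitKernel r).comp (measurable_update t))
      (differentiableOn_limitKernel_update ht) (fun z hz => norm_apply_update_le hK ht hz)
      hε hεr (hs k)

theorem hankelIntegral_div (f : (Fin r → ℂ) → ℂ) (a : ℂ) :
    hankelIntegral r ε (fun t => f t / a) s = hankelIntegral r ε f s / a := by
  rw [hankelIntegral, hankelIntegral, ← integral_div]
  simp only [div_mul_eq_mul_div]

theorem tendsto_hankelIntegral_kernel_div (hs : ∀ k, 0 < (s k).re) (hε : 0 < ε)
    (hεr : ε < polyWidth r) :
    Tendsto (fun c : ℝ => hankelIntegral r ε (kernel r c) s / (1 - c) ^ r) (𝓝[≠] 1)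
      (𝓝 (hankelIntegral r ε (limitKernel r) s)) := by
  obtain ⟨K, hK⟩ := exists_norm_kernel_div_le r
  simp only [← hankelIntegral_div]
  simp only [hankelIntegral_eq_piIntegral hs hε hεr]
  exact WeightedCurve.tendsto_piIntegral _ (fun c => (measurable_kernel r c).div_const _) hK
    fun t ht => tendsto_kernel_div ht

theorem exp_two_pi_mul_I_mul_ne_one {s : ℂ} (hs : s ∉ Set.range ((↑) : ℤ → ℂ)) :
    exp (2 * Real.pi * I * s) ≠ 1 := by
  intro h
  obtain ⟨n, hn⟩ := exp_eq_one_iff.1 h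
  rw [mul_comm (n : ℂ)] at hn
  exact hs ⟨n, (mul_left_cancel₀ two_pi_I_ne_zero hn).symm⟩

theorem hankelCoeff_mul_prod (hs : s ∈ nonint r) :
    hankelCoeff r s * ∏ k, (exp (2 * Real.pi * I * s k) - 1) = ∏ k, (Gamma (s k))⁻¹ := by
  rw [hankelCoeff, ← Finset.prod_mul_distrib]
  refine Finset.prod_congr rfl fun k _ => ?_
  have hne := sub_ne_zero.2 (exp_two_pi_mul_I_mul_ne_one (hs k))
  rw [one_div, mul_inv_rev, mul_assoc, inv_mul_cancel₀ hne, mul_one]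

theorem isDesZetaLimit_mellinDes (hs : ∀ k, 0 < (s k).re) (hsn : s ∈ nonint r) :
    IsDesZetaLimit r s (mellinDes r s) := by
  filter_upwards [Ioo_mem_nhdsGT (polyWidth_pos r)] with ε hε
  rw [mellinDes_eq_piIntegral hs, ← hankelCoeff_mul_prod hsn, mul_assoc,
    ← hankelIntegral_limitKernel hs hε.1 hε.2]
  refine ((tendsto_hankelIntegral_kernel_div hs hε.1 hε.2).const_mul _).congr fun c => ?_
  ring

end Limit

/-! ### Holomorphy of the Mellin transform -/

section Laplace

variable {ι : Type*} [Fintype ι]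

theorem norm_exp_sum_mul_ofReal (s : ι → ℂ) (ℓ : ι → ℝ) :
    ‖exp (∑ k, s k * ℓ k)‖ = Real.exp (∑ k, (s k).re * ℓ k) := by
  rw [norm_exp, re_sum]
  simp only [re_mul_ofReal]

/-- The linear form `s ↦ ∑ k, ℓ k * s k`. -/
def sumForm (ℓ : ι → ℝ) : (ι → ℂ) →L[ℂ] ℂ := ∑ k, (ℓ k : ℂ) • ContinuousLinearMap.proj k

theorem norm_sumForm_le (ℓ : ι → ℝ) : ‖sumForm ℓ‖ ≤ ∑ k, |ℓ k| := by
  refine (norm_sum_le _ _).trans (Finset.sum_le_sum fun k _ => ?_)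
  rw [norm_smul, norm_real, Real.norm_eq_abs]
  refine mul_le_of_le_one_right (abs_nonneg _) ?_
  exact ContinuousLinearMap.opNorm_le_bound _ zero_le_one fun y => by
    simpa using norm_le_pi_norm y k

theorem hasFDerivAt_exp_sum_mul (ℓ : ι → ℝ) (s : ι → ℂ) :
    HasFDerivAt (fun s : ι → ℂ => exp (∑ k, s k * ℓ k)) (exp (∑ k, s k * ℓ k) • sumForm ℓ) s :=
  (HasFDerivAt.fun_sum fun k _ => (hasFDerivAt_apply k s).mul_const (ℓ k : ℂ)).cexp

/-- The points `s + δ σ`, with signs `σ`, around `s`. -/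
def signShift (s : ι → ℂ) (δ : ℝ) (σ : ι → SignType) (k : ι) : ℂ := s k + (δ * σ k : ℝ)

theorem signShift_mem_closedBall (s : ι → ℂ) {δ : ℝ} (hδ : 0 ≤ δ) (σ : ι → SignType) :
    signShift s δ σ ∈ Metric.closedBall s δ := by
  rw [mem_closedBall_iff_norm, pi_norm_le_iff_of_nonneg hδ]
  intro k
  have hsign : ‖((σ k : SignType) : ℝ)‖ ≤ 1 := by cases σ k <;> simp
  rw [Pi.sub_apply, signShift, add_sub_cancel_left, norm_real, norm_mul, Real.norm_of_nonneg hδ]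
  exact mul_le_of_le_one_right hδ hsign

theorem sum_abs_mul_norm_exp_le {s s' : ι → ℂ} {δ : ℝ} (hδ : 0 < δ) (hs : ‖s' - s‖ ≤ δ)
    (ℓ : ι → ℝ) :
    (∑ k, |ℓ k|) * ‖exp (∑ k, s' k * ℓ k)‖ ≤
      δ⁻¹ * ‖exp (∑ k, signShift s (2 * δ) (SignType.sign ∘ ℓ) k * ℓ k)‖ := by
  have hlinear : ∑ k, |ℓ k| ≤ δ⁻¹ * Real.exp (δ * ∑ k, |ℓ k|) := by
    rw [← div_eq_inv_mul, le_div_iff₀' hδ]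
    linarith [Real.add_one_le_exp (δ * ∑ k, |ℓ k|)]
  have hexponent : ∀ k, δ * |ℓ k| + (s' k).re * ℓ k ≤
      (signShift s (2 * δ) (SignType.sign ∘ ℓ) k).re * ℓ k := by
    intro k
    have hre : |(s' k).re - (s k).re| ≤ δ :=
      (abs_re_le_norm (s' k - s k)).trans ((norm_le_pi_norm (s' - s) k).trans hs)
    have hmul : ((s' k).re - (s k).re) * ℓ k ≤ δ * |ℓ k| :=
      (le_abs_self _).trans (by rw [abs_mul]; gcongr)
    rw [signShift, add_re, ofReal_re, add_mul, mul_assoc (2 * δ), Function.comp_apply,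
      sign_mul_self]
    linarith
  rw [norm_exp_sum_mul_ofReal, norm_exp_sum_mul_ofReal]
  calc (∑ k, |ℓ k|) * Real.exp (∑ k, (s' k).re * ℓ k)
      ≤ δ⁻¹ * Real.exp (δ * ∑ k, |ℓ k|) * Real.exp (∑ k, (s' k).re * ℓ k) := by gcongr
    _ = δ⁻¹ * Real.exp (∑ k, (δ * |ℓ k| + (s' k).re * ℓ k)) := by
        rw [mul_assoc, ← Real.exp_add, Finset.mul_sum, Finset.sum_add_distrib]
    _ ≤ _ := by gcongr; exact hexponent _

theorem norm_mul_exp_smul_sumForm_le [DecidableEq ι] {s s' : ι → ℂ} {δ : ℝ} (hδ : 0 < δ)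
    (hs : ‖s' - s‖ ≤ δ) (ℓ : ι → ℝ) (c : ℂ) :
    ‖(c * exp (∑ k, s' k * ℓ k)) • sumForm ℓ‖ ≤
      δ⁻¹ * ∑ σ, ‖c * exp (∑ k, signShift s (2 * δ) σ k * ℓ k)‖ := by
  calc ‖(c * exp (∑ k, s' k * ℓ k)) • sumForm ℓ‖
      ≤ ‖c‖ * ((∑ k, |ℓ k|) * ‖exp (∑ k, s' k * ℓ k)‖) := by
        rw [norm_smul, norm_mul, mul_assoc, mul_comm ‖exp _‖]
        gcongr
        exact norm_sumForm_le ℓ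
    _ ≤ ‖c‖ * (δ⁻¹ * ‖exp (∑ k, signShift s (2 * δ) (SignType.sign ∘ ℓ) k * ℓ k)‖) :=
        mul_le_mul_of_nonneg_left (sum_abs_mul_norm_exp_le hδ hs ℓ) (norm_nonneg c)
    _ ≤ _ := by
        rw [mul_left_comm, ← norm_mul]
        gcongr
        exact Finset.single_le_sum
          (f := fun σ => ‖c * exp (∑ k, signShift s (2 * δ) σ k * ℓ k)‖)
          (fun _ _ => norm_nonneg _) (Finset.mem_univ _)

-- On the ball of radius `δ` around `s` the derivative is dominated by the sum of the norms of the
-- integrands at the finitely many points `signShift s (2 * δ) σ`.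
theorem differentiableOn_integral_mul_exp {X : Type*} [MeasurableSpace X] {μ : Measure X}
    {g : X → ℂ} {L : ι → X → ℝ} {U : Set (ι → ℂ)} (hU : IsOpen U) (hL : ∀ k, Measurable (L k))
    (hint : ∀ s ∈ U, Integrable (fun x => g x * exp (∑ k, s k * L k x)) μ) :
    DifferentiableOn ℂ (fun s => ∫ x, g x * exp (∑ k, s k * L k x) ∂μ) U := by
  classical
  intro s hs
  obtain ⟨ρ, hρ, hball⟩ := Metric.nhds_basis_closedBall.mem_iff.1 (hU.mem_nhds hs)
  have shift_mem : ∀ σ, signShift s (2 * (ρ / 2)) σ ∈ U := by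
    rw [mul_div_cancel₀ _ two_ne_zero]
    exact fun σ => hball (signShift_mem_closedBall s hρ.le σ)
  refine (hasFDerivAt_integral_of_dominated_of_fderiv_le
    (F' := fun s x => (g x * exp (∑ k, s k * L k x)) • sumForm (L · x))
    (bound := fun x => (ρ / 2)⁻¹ *
      ∑ σ, ‖g x * exp (∑ k, signShift s (2 * (ρ / 2)) σ k * L k x)‖)
    (Metric.ball_mem_nhds s (half_pos hρ)) ?_ (hint s hs) ?_ ?_ ?_
    ?_).differentiableAt.differentiableWithinAt
  · filter_upwards [hU.mem_nhds hs] with s' hs'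
    exact (hint s' hs').aestronglyMeasurable
  · refine (hint s hs).aestronglyMeasurable.smul
      (Finset.aestronglyMeasurable_fun_sum _ fun k _ => ?_)
    exact (measurable_ofReal.comp (hL k)).aestronglyMeasurable.smul_const _
  · exact ae_of_all _ fun x s' hs' =>
      norm_mul_exp_smul_sumForm_le (half_pos hρ) (mem_ball_iff_norm.1 hs').le _ _
  · exact (integrable_finsetSum _ fun σ _ => (hint _ (shift_mem σ)).norm).const_mul _
  · refine ae_of_all _ fun x s' _ => ?_
    rw [mul_smul]
    exact (hasFDerivAt_exp_sum_mul (L · x) s').const_mul (g x)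

end Laplace

section Continuation

variable {r : ℕ}

theorem isOpen_forall_re_pos (r : ℕ) : IsOpen {s : Fin r → ℂ | ∀ k, 0 < (s k).re} := by
  simp only [Set.ofPred_forall]
  exact isOpen_iInter_of_finite fun k =>
    isOpen_lt continuous_const (continuous_re.comp (continuous_apply k))

theorem prod_cpow_sub_one {x : Fin r → ℝ} (hx : ∀ k, 0 < x k) (s : Fin r → ℂ) :
    ∏ k, (x k : ℂ) ^ (s k - 1) =
      exp (-∑ k, (Real.log (x k) : ℂ)) * exp (∑ k, s k * Real.log (x k)) := by
  rw [← exp_add, neg_add_eq_sub, ← Finset.sum_sub_distrib, exp_sum]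
  refine Finset.prod_congr rfl fun k _ => ?_
  rw [cpow_sub_one_eq_exp (hx k), sub_one_mul]

theorem ae_pi_forall_pos (r : ℕ) :
    ∀ᵐ x ∂Measure.pi fun _ : Fin r => volume.restrict (Set.Ioi (0 : ℝ)), ∀ k, 0 < x k :=
  eventually_all.2 fun k => (Measure.tendsto_eval_ae_ae (i := k)
    (μ := fun _ : Fin r => volume.restrict (Set.Ioi (0 : ℝ)))).eventually
      (ae_restrict_mem measurableSet_Ioi)

theorem differentiableOn_mellinDes (r : ℕ) :
    DifferentiableOn ℂ (mellinDes r) {s | ∀ k, 0 < (s k).re} := by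
  refine .mul ?_ ?_
  · have hGamma : ∀ k, Differentiable ℂ fun s : Fin r → ℂ => (Gamma (s k))⁻¹ := fun k =>
      differentiable_one_div_Gamma.comp (differentiable_apply k)
    exact fun s _ => (HasFDerivAt.finsetProd fun k _ =>
      (hGamma k s).hasFDerivAt).differentiableAt.differentiableWithinAt
  · have hlaplace : ∀ s : Fin r → ℂ,
        (fun x : Fin r → ℝ => limitKernel r (fun k => x k) * ∏ k, (x k : ℂ) ^ (s k - 1))
          =ᵐ[Measure.pi fun _ => volume.restrict (Set.Ioi 0)] fun x =>
        limitKernel r (fun k => x k) * exp (-∑ k, (Real.log (x k) : ℂ)) *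
          exp (∑ k, s k * Real.log (x k)) := by
      intro s
      filter_upwards [ae_pi_forall_pos r] with x hx
      rw [prod_cpow_sub_one hx, mul_assoc]
    simp only [integral_congr_ae (hlaplace _)]
    exact differentiableOn_integral_mul_exp (isOpen_forall_re_pos r)
      (fun k => Real.measurable_log.comp (measurable_pi_apply k))
      fun s hs => (integrable_limitKernel_mul_cpow hs).congr (hlaplace s)

theorem isDesZetaValue_mellinDes {s : Fin r → ℂ} (hs : ∀ k, 0 < (s k).re) :
    IsDesZetaValue r s (mellinDes r s) :=
  ⟨_, mellinDes r, isOpen_forall_re_pos r, hs, differentiableOn_mellinDes r,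
    fun _ hz => isDesZetaLimit_mellinDes hz.1 hz.2, rfl⟩

theorem desZeta_eq_mellinDes {s : Fin r → ℂ} (hs : ∀ k, 0 < (s k).re) :
    desZeta r s = mellinDes r s := by
  have h : ∃ v, IsDesZetaValue r s v := ⟨_, isDesZetaValue_mellinDes hs⟩
  rw [desZeta, dif_pos h]
  exact h.choose_spec.unique (isDesZetaValue_mellinDes hs)

end Continuation

/-! ### The shuffle product of moments -/

section Quadrant

variable {E : Type*} [NormedAddCommGroup E]

/-- The open quadrant `(0, ∞)²`. -/
def quadrant : Set (ℝ × ℝ) := Set.Ioi 0 ×ˢ Set.Ioi 0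

theorem volume_restrict_quadrant :
    volume.restrict quadrant =
      (volume.restrict (Set.Ioi (0 : ℝ))).prod (volume.restrict (Set.Ioi (0 : ℝ))) :=
  (Measure.prod_restrict _ _).symm

theorem measurableSet_quadrant : MeasurableSet quadrant := measurableSet_Ioi.prod measurableSet_Ioi

theorem measurePreserving_shear_quadrant :
    MeasurePreserving (fun z : ℝ × ℝ => (z.2, z.2 + z.1)) (volume.restrict quadrant)
      (volume.restrict (quadrant ∩ {z | z.1 < z.2})) := by
  have hpreimage : quadrant =
      (fun z : ℝ × ℝ => (z.2, z.2 + z.1)) ⁻¹' (quadrant ∩ {z | z.1 < z.2}) := by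
    ext z
    simp only [quadrant, Set.mem_preimage, Set.mem_inter_iff, Set.mem_prod, Set.mem_Ioi,
      Set.mem_ofPred_eq, lt_add_iff_pos_right]
    exact ⟨fun h => ⟨⟨h.2, add_pos h.2 h.1⟩, h.1⟩, fun h => ⟨h.2, h.1.1⟩⟩
  nth_rw 1 [hpreimage]
  exact ((measurePreserving_prod_add volume volume).comp
    Measure.measurePreserving_swap).restrict_preimage
    (measurableSet_quadrant.inter (measurableSet_lt measurable_fst measurable_snd))

theorem integrableOn_comp_shear {h : ℝ × ℝ → E} (hh : IntegrableOn h quadrant) :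
    IntegrableOn (fun z => h (z.2, z.2 + z.1)) quadrant :=
  measurePreserving_shear_quadrant.integrable_comp_of_integrable
    (hh.mono_set Set.inter_subset_left)

variable [NormedSpace ℝ E]

theorem setIntegral_comp_shear (h : ℝ × ℝ → E) :
    ∫ z in quadrant, h (z.2, z.2 + z.1) = ∫ z in quadrant ∩ {z | z.1 < z.2}, h z :=
  measurePreserving_shear_quadrant.integral_comp
    (MeasurableEquiv.prodComm.trans (MeasurableEquiv.shearAddRight ℝ)).measurableEmbedding h

theorem setIntegral_comp_shear_swap (h : ℝ × ℝ → E) :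
    ∫ z in quadrant, h (z.2 + z.1, z.2) = ∫ z in quadrant ∩ {z | z.2 < z.1}, h z := by
  have hpreimage : quadrant ∩ {z | z.1 < z.2} = Prod.swap ⁻¹' (quadrant ∩ {z | z.2 < z.1}) := by
    ext z
    simp [quadrant, and_comm]
  refine (setIntegral_comp_shear fun z => h z.swap).trans ?_
  rw [hpreimage]
  exact (Measure.measurePreserving_swap (μ := volume) (ν := volume)).setIntegral_preimage_emb
    MeasurableEquiv.prodComm.measurableEmbedding h _

theorem ae_fst_ne_snd : ∀ᵐ z : ℝ × ℝ, z.1 ≠ z.2 :=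
  (Measure.ae_prod_iff_ae_ae (measurableSet_eq_fun measurable_fst measurable_snd).compl).2
    (ae_of_all _ fun x => by simp [ae_iff])

theorem setIntegral_quadrant_eq_add {h : ℝ × ℝ → E} (hh : IntegrableOn h quadrant) :
    ∫ z in quadrant, h z =
      (∫ z in quadrant, h (z.2 + z.1, z.2)) + ∫ z in quadrant, h (z.2, z.2 + z.1) := by
  have hdiff : (quadrant \ {z | z.1 < z.2} : Set (ℝ × ℝ)) =ᵐ[volume]
      (quadrant ∩ {z | z.2 < z.1} : Set (ℝ × ℝ)) := by
    filter_upwards [ae_fst_ne_snd] with z hz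
    refine propext (and_congr_right fun _ => ?_)
    rw [Set.mem_ofPred_eq, Set.mem_ofPred_eq, not_lt]
    exact ⟨fun hle => hle.lt_of_ne' hz, le_of_lt⟩
  rw [setIntegral_comp_shear, setIntegral_comp_shear_swap, ← setIntegral_congr_set hdiff, add_comm,
    integral_inter_add_sdiff (measurableSet_lt measurable_fst measurable_snd) hh]

end Quadrant

theorem add_pow_div_factorial_mul_pow_div_factorial {K : Type*} [Field K] [CharZero K]
    (x y : K) (p q : ℕ) :
    (x + y) ^ p / p.factorial * (y ^ q / q.factorial) =
      ∑ ij ∈ antidiagonal (p + q), (ij.2.choose q : K) *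
        (x ^ ij.1 / ij.1.factorial * (y ^ ij.2 / ij.2.factorial)) := by
  have hvanish : ∀ i ∈ Finset.range (p + q + 1), i ∉ Finset.range (p + 1) →
      ((p + q - i).choose q : K) *
        (x ^ i / i.factorial * (y ^ (p + q - i) / (p + q - i).factorial)) = 0 := by
    intro i hi hip
    simp only [Finset.mem_range] at hi hip
    rw [Nat.choose_eq_zero_of_lt (by omega), Nat.cast_zero, zero_mul]
  rw [Finset.Nat.sum_antidiagonal_eq_sum_range_succ_mk, ← Finset.sum_subset
    (Finset.range_subset_range.2 (by omega)) hvanish, add_pow, Finset.sum_div, Finset.sum_mul]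
  refine Finset.sum_congr rfl fun i hi => ?_
  obtain ⟨k, rfl⟩ := Nat.exists_eq_add_of_le (Finset.mem_range_succ_iff.1 hi)
  rw [Nat.add_sub_cancel_left, add_assoc i k q, Nat.add_sub_cancel_left, Nat.cast_add_choose,
    ← Nat.choose_symm_add, Nat.cast_add_choose, pow_add]
  have hfactorial : ∀ n : ℕ, (n.factorial : K) ≠ 0 := fun n => mod_cast n.factorial_ne_zero
  field_simp [hfactorial]

section Moments

variable {φ : ℝ → ℂ}

theorem integrableOn_mul_mul_pow_mul_pow
    (hφ : ∀ k : ℕ, IntegrableOn (fun x : ℝ => φ x * (x : ℂ) ^ k) (Set.Ioi 0)) (i j : ℕ) :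
    IntegrableOn (fun z : ℝ × ℝ => φ (z.2 + z.1) * φ z.2 * ((z.1 : ℂ) ^ i * (z.2 : ℂ) ^ j))
      quadrant := by
  have hshear : ∀ i j : ℕ, IntegrableOn (fun z : ℝ × ℝ =>
      φ z.2 * (z.2 : ℂ) ^ j * (φ (z.2 + z.1) * ((z.2 + z.1 : ℝ) : ℂ) ^ i)) quadrant := by
    intro i j
    refine integrableOn_comp_shear (h := fun z : ℝ × ℝ =>
      φ z.1 * (z.1 : ℂ) ^ j * (φ z.2 * (z.2 : ℂ) ^ i)) ?_
    rw [IntegrableOn, volume_restrict_quadrant]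
    exact (hφ j).mul_prod (hφ i)
  have hmeas := (hshear 0 0).aestronglyMeasurable
  simp only [pow_zero, mul_one] at hmeas
  refine Integrable.mono (hshear i j) ?_ ?_
  · simp only [mul_comm (φ (_ + _))]
    exact hmeas.mul (by fun_prop)
  · filter_upwards [ae_restrict_mem measurableSet_quadrant] with z hz
    obtain ⟨hx : 0 < z.1, hy : 0 < z.2⟩ := hz
    have hpow : ‖(z.1 : ℂ) ^ i‖ ≤ ‖((z.2 + z.1 : ℝ) : ℂ) ^ i‖ := by
      rw [norm_pow, norm_pow, norm_real, norm_real, Real.norm_of_nonneg hx.le,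
        Real.norm_of_nonneg (add_pos hy hx).le]
      gcongr
      linarith
    calc ‖φ (z.2 + z.1) * φ z.2 * ((z.1 : ℂ) ^ i * (z.2 : ℂ) ^ j)‖
        = ‖φ z.2 * (z.2 : ℂ) ^ j * φ (z.2 + z.1)‖ * ‖(z.1 : ℂ) ^ i‖ := by
          rw [← norm_mul]
          ring_nf
      _ ≤ ‖φ z.2 * (z.2 : ℂ) ^ j * φ (z.2 + z.1)‖ * ‖((z.2 + z.1 : ℝ) : ℂ) ^ i‖ := by gcongr
      _ = _ := by rw [← norm_mul, mul_assoc]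

/-- The normalized double moment `∫∫ φ(x + y) φ(y) x^i/i! y^j/j! dx dy` over the quadrant. -/
def doubleMoment (φ : ℝ → ℂ) (i j : ℕ) : ℂ :=
  ∫ z in quadrant, φ (z.2 + z.1) * φ z.2 *
    ((z.1 : ℂ) ^ i / i.factorial * ((z.2 : ℂ) ^ j / j.factorial))

theorem setIntegral_shear_eq_sum_doubleMoment
    (hφ : ∀ k : ℕ, IntegrableOn (fun x : ℝ => φ x * (x : ℂ) ^ k) (Set.Ioi 0)) (p q : ℕ) :
    ∫ z in quadrant, φ (z.2 + z.1) * (((z.2 + z.1 : ℝ) : ℂ) ^ p / p.factorial) *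
        (φ z.2 * ((z.2 : ℂ) ^ q / q.factorial)) =
      ∑ ij ∈ antidiagonal (p + q), (ij.2.choose q : ℂ) * doubleMoment φ ij.1 ij.2 := by
  have hexpand : ∀ z : ℝ × ℝ, φ (z.2 + z.1) * (((z.2 + z.1 : ℝ) : ℂ) ^ p / p.factorial) *
      (φ z.2 * ((z.2 : ℂ) ^ q / q.factorial)) =
      ∑ ij ∈ antidiagonal (p + q), (ij.2.choose q : ℂ) * (φ (z.2 + z.1) * φ z.2 *
        ((z.1 : ℂ) ^ ij.1 / ij.1.factorial * ((z.2 : ℂ) ^ ij.2 / ij.2.factorial))) := by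
    intro z
    rw [mul_mul_mul_comm, ofReal_add, add_comm (z.2 : ℂ),
      add_pow_div_factorial_mul_pow_div_factorial, Finset.mul_sum]
    exact Finset.sum_congr rfl fun _ _ => mul_left_comm _ _ _
  simp only [hexpand]
  rw [integral_finsetSum]
  · simp only [integral_const_mul, doubleMoment]
  · intro ij _
    refine Integrable.const_mul ?_ _
    simp only [div_mul_div_comm]
    simp only [← mul_div_assoc]
    exact (integrableOn_mul_mul_pow_mul_pow hφ ij.1 ij.2).div_const _

theorem setIntegral_mul_setIntegral_eq_sum_doubleMoment
    (hφ : ∀ k : ℕ, IntegrableOn (fun x : ℝ => φ x * (x : ℂ) ^ k) (Set.Ioi 0)) (p q : ℕ) :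
    (∫ x in Set.Ioi (0 : ℝ), φ x * ((x : ℂ) ^ p / p.factorial)) *
        (∫ y in Set.Ioi (0 : ℝ), φ y * ((y : ℂ) ^ q / q.factorial)) =
      ∑ ij ∈ antidiagonal (p + q),
        ((ij.2.choose p : ℂ) + ij.2.choose q) * doubleMoment φ ij.1 ij.2 := by
  have hmoment : ∀ k : ℕ,
      IntegrableOn (fun x : ℝ => φ x * ((x : ℂ) ^ k / k.factorial)) (Set.Ioi 0) := by
    intro k
    simp only [← mul_div_assoc]
    exact (hφ k).div_const _
  have hprod : IntegrableOn (fun z : ℝ × ℝ => φ z.1 * ((z.1 : ℂ) ^ p / p.factorial) *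
      (φ z.2 * ((z.2 : ℂ) ^ q / q.factorial))) quadrant := by
    rw [IntegrableOn, volume_restrict_quadrant]
    exact (hmoment p).mul_prod (hmoment q)
  rw [← integral_prod_mul, ← volume_restrict_quadrant, setIntegral_quadrant_eq_add hprod,
    setIntegral_shear_eq_sum_doubleMoment hφ]
  simp only [mul_comm (φ (Prod.snd _) * (_ / (p.factorial : ℂ)))]
  rw [setIntegral_shear_eq_sum_doubleMoment hφ, add_comm q p, add_comm, ← Finset.sum_add_distrib]
  simp only [add_mul]

end Moments

/-! ### The values at positive integers -/

theorem limitKernel_one (t : Fin 1 → ℂ) : limitKernel 1 t = limitFactor (t 0) := by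
  have hIci : Finset.Ici (0 : Fin 1) = {0} := by decide
  simp [limitKernel, hIci]

theorem limitKernel_two (t : Fin 2 → ℂ) :
    limitKernel 2 t = limitFactor (t 0 + t 1) * limitFactor (t 1) := by
  have hIci_zero : Finset.Ici (0 : Fin 2) = {0, 1} := by decide
  have hIci_one : Finset.Ici (1 : Fin 2) = {1} := by decide
  simp [limitKernel, Fin.prod_univ_two, hIci_zero, hIci_one]

theorem natCast_re_pos_one {n : ℕ} (hn : 0 < n) (k : Fin 1) :
    0 < ((![(n : ℂ)] : Fin 1 → ℂ) k).re := by
  simpa using hn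

theorem natCast_re_pos_two {i j : ℕ} (hi : 0 < i) (hj : 0 < j) (k : Fin 2) :
    0 < ((![(i : ℂ), (j : ℂ)] : Fin 2 → ℂ) k).re := by
  fin_cases k
  · simpa using hi
  · simpa using hj

theorem integrableOn_limitFactor_mul_pow (k : ℕ) :
    IntegrableOn (fun x : ℝ => limitFactor x * (x : ℂ) ^ k) (Set.Ioi 0) := by
  refine ((measurePreserving_piUnique fun _ : Fin 1 =>
    volume.restrict (Set.Ioi (0 : ℝ))).integrable_comp_emb
    (MeasurableEquiv.measurableEmbedding _)).1 ?_
  simpa [limitKernel_one, Function.comp_def] using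
    integrable_limitKernel_mul_cpow (natCast_re_pos_one k.succ_pos)

theorem mellinDes_natCast_one {n : ℕ} (hn : 0 < n) :
    mellinDes 1 ![(n : ℂ)] =
      ∫ x in Set.Ioi (0 : ℝ), limitFactor x * ((x : ℂ) ^ (n - 1) / (n - 1).factorial) := by
  obtain ⟨p, rfl⟩ := Nat.exists_eq_add_one.2 hn
  rw [mellinDes, ← integral_const_mul, ← (measurePreserving_piUnique fun _ : Fin 1 =>
    volume.restrict (Set.Ioi (0 : ℝ))).integral_comp']
  congr 1
  ext x
  simp only [Fin.prod_univ_one, limitKernel_one, Matrix.cons_val_zero, Nat.cast_add, Nat.cast_one,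
    Gamma_nat_eq_factorial, add_sub_cancel_right, cpow_natCast, add_tsub_cancel_right,
    MeasurableEquiv.piUnique_apply, Fin.default_eq_zero]
  rw [inv_mul_eq_div, mul_div_assoc]

theorem mellinDes_natCast_two {i j : ℕ} (hi : 0 < i) (hj : 0 < j) :
    mellinDes 2 ![(i : ℂ), (j : ℂ)] = doubleMoment (fun x => limitFactor x) (i - 1) (j - 1) := by
  obtain ⟨i, rfl⟩ := Nat.exists_eq_add_one.2 hi
  obtain ⟨j, rfl⟩ := Nat.exists_eq_add_one.2 hj
  rw [mellinDes, doubleMoment, volume_restrict_quadrant, ← integral_const_mul,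
    ← (measurePreserving_piFinTwo fun _ => volume.restrict (Set.Ioi (0 : ℝ))).integral_comp']
  congr 1
  ext x
  simp only [Fin.prod_univ_two, limitKernel_two, Matrix.cons_val_zero, Matrix.cons_val_one,
    Nat.cast_add, Nat.cast_one, Gamma_nat_eq_factorial, add_sub_cancel_right, cpow_natCast,
    add_tsub_cancel_right, MeasurableEquiv.piFinTwo_apply, ofReal_add]
  rw [add_comm (x 0 : ℂ)]
  ring

theorem sum_antidiagonal_eq_sum_Icc {M : Type*} [AddCommMonoid M] (f : ℕ × ℕ → M) (N : ℕ) :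
    ∑ ij ∈ antidiagonal N, f ij = ∑ j ∈ Finset.Icc 1 (N + 1), f (N + 1 - j, j - 1) := by
  refine Finset.sum_nbij' (fun ij => ij.2 + 1) (fun j => (N + 1 - j, j - 1)) ?_ ?_ ?_ ?_ ?_ <;>
    grind [Finset.HasAntidiagonal.mem_antidiagonal]

theorem desZeta_one_mul_desZeta_one {n m : ℕ} (hn : 0 < n) (hm : 0 < m) :
    desZeta 1 ![(n : ℂ)] * desZeta 1 ![(m : ℂ)] =
      ∑ j ∈ Finset.Icc 1 (n + m - 1), (((j - 1).choose (n - 1) : ℂ) + (j - 1).choose (m - 1)) *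
        desZeta 2 ![((n + m - j : ℕ) : ℂ), (j : ℂ)] := by
  rw [desZeta_eq_mellinDes (natCast_re_pos_one hn), desZeta_eq_mellinDes (natCast_re_pos_one hm),
    mellinDes_natCast_one hn, mellinDes_natCast_one hm,
    setIntegral_mul_setIntegral_eq_sum_doubleMoment integrableOn_limitFactor_mul_pow,
    sum_antidiagonal_eq_sum_Icc]
  have hweight : n - 1 + (m - 1) + 1 = n + m - 1 := by omega
  rw [hweight]
  refine Finset.sum_congr rfl fun j hj => ?_
  obtain ⟨hj0, hj1⟩ := Finset.mem_Icc.1 hj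
  have hi0 : 0 < n + m - j := by omega
  rw [desZeta_eq_mellinDes (natCast_re_pos_two hi0 hj0), mellinDes_natCast_two hi0 hj0,
    Nat.sub_right_comm]

end DesMZF

end

theorem mainTheorem6 (n m : ℕ) (hn : 0 < n) (hm : 0 < m) :
    (∃ v, DesMZF.IsDesZetaValue 1 ![(n : ℂ)] v) ∧
    (∃ v, DesMZF.IsDesZetaValue 1 ![(m : ℂ)] v) ∧
    (∀ j ∈ Finset.Icc 1 (n + m - 1),
      ∃ v, DesMZF.IsDesZetaValue 2 ![(n : ℂ) + (m : ℂ) - (j : ℂ), (j : ℂ)] v) ∧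
    DesMZF.desZeta 1 ![(n : ℂ)] * DesMZF.desZeta 1 ![(m : ℂ)] =
      ∑ j ∈ Finset.Icc 1 (n + m - 1),
        (((j - 1).choose (n - 1) : ℂ) + ((j - 1).choose (m - 1) : ℂ)) *
          DesMZF.desZeta 2 ![(n : ℂ) + (m : ℂ) - (j : ℂ), (j : ℂ)] := by
  have hcast : ∀ j ∈ Finset.Icc 1 (n + m - 1), (n : ℂ) + m - j = (n + m - j : ℕ) := by
    intro j hj
    rw [Nat.cast_sub (by grind), Nat.cast_add]
  refine ⟨⟨_, DesMZF.isDesZetaValue_mellinDes (DesMZF.natCast_re_pos_one hn)⟩,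
    ⟨_, DesMZF.isDesZetaValue_mellinDes (DesMZF.natCast_re_pos_one hm)⟩, fun j hj => ?_, ?_⟩
  · rw [hcast j hj]
    exact ⟨_, DesMZF.isDesZetaValue_mellinDes (DesMZF.natCast_re_pos_two (by grind) (by grind))⟩
  · rw [DesMZF.desZeta_one_mul_desZeta_one hn hm]
    exact Finset.sum_congr rfl fun j hj => by rw [hcast j hj]
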